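/- Let $\Sigma$ be a compact connected Riemann surface and let $\mathcal C=(\Sigma,x,y)$ be a spectral curve: $x$ is a meromorphic function on $\Sigma$ whose poles are called the boundary points, $dx$ has finitely many zeros $z^1,\dots,z^N$ away from the boundary points (the critical points), all of them simple, and $y$ is holomorphic near each $z^\beta$ with $dy(z^\beta)\neq 0$. Let $B$ be a Bergman kernel of $\Sigma$, i.e. a symmetric bidifferential on $\Sigma\times\Sigma$, holomorphic off the diagonal and of the form $\frac{dw\,dv}{(w-v)^2}+\text{(holomorphic)}$ in local coordinates near the diagonal (for instance the one with vanishing $\mathcal A$-periods for a chosen symplectic basis of $H_1(\Sigma,\mathbb C)$). Put $x^\beta=x(z^\beta)$, let $\eta^\beta$ be a local Airy coordinate at $z^\beta$, $x=x^\beta+\frac12(\eta^\beta)^2$, and define the meromorphic one-forms $$d\zeta^{\bar\beta}(z)=-\operatorname{Res}_{z'=z^\beta}\frac{B(z',z)}{\eta^\beta(z')},\qquad d\zeta^{\bar\beta}_k=\Big(-d\circ\frac1{dx}\Big)^k d\zeta^{\bar\beta},\quad k\ge 0 .$$ Let $H=\mathbb C^N$ with orthonormal basis $\bar e_1,\dots,\bar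 e_N$, and let $e_\beta=\frac{dy}{d\eta^\beta}(z^\beta)\,\bar e_\beta$, with the commutative product $*$ on $H$ given by $e_\beta*e_\gamma=\delta_{\beta\gamma}e_\beta$, and let $E_0=\sum_\beta x^\beta e_\beta$. For each $\gamma$ let $\mathfrak L_\gamma$ be a Lefschetz thimble: a path through $z^\gamma$ and no other critical point, avoiding the boundary points, parametrized by $t$ in a closed (bounded or unbounded) interval around $0$ so that $x=x^\gamma+\frac{t^2}{2}$ along it and $t=\eta^\gamma$ near $z^\gamma$; integrals along it of forms with a pole at $z^\gamma$ are taken along the path indented at $z^\gamma$. Then there is a unique sequence $R_0,R_1,\dots$ of $N\times N$ matrices (the $R$-matrix $R(u)=\sum_{k\ge0}R_ku^k\in\operatorname{End}(H)[[u]]$, with entries $(R_k)^{\bar\beta}_{\bar\gamma}$ the $\bar e_\beta$-component of $R_k\bar e_\gamma$) such that for all $\beta,\gamma$, as $u\to0^+$, in the sense of asymptotic expansions, $$\frac{u}{\sqrt{2\pi u}}\int_{\mathfrak L_\gamma}e^{-x(z)/u}\,d\zeta^{\bar\beta}(z)\;\asymp\; e^{-x^\gamma/u}\sum_{k\ge0}(R_k)^{\bar\beta}_{\bar\gamma}(-u)^k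 .$$ Put $\mu=[R_1,E_0*]$. The spectral curve is homogeneous, meaning that $$(x-x^\beta)\,d\zeta^{\bar\beta}_1=\sum_{\gamma}\big(\mu+\tfrac32\big)^{\bar\beta}_{\bar\gamma}\,d\zeta^{\bar\gamma}_0\qquad\text{for every }\beta=1,\dots,N$$ as meromorphic one-forms on $\Sigma$, if and only if $$[R_{m+1},E_0*]=(m+\mu)R_m\qquad\text{for all } m\ge0 .$$ -/

import Mathlib

open Set Filter Topology
open scoped Manifold ContDiff

noncomputable section

/-! ### Differential forms on a Riemann surface -/

/-- A (possibly meromorphic) one-form on the Riemann surface `S`, recorded by its coefficients: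
`α p` is the coefficient of `α` at `p` with respect to the differential of the preferred local
coordinate `chartAt ℂ p`, i.e. `α_p = α p • d(chartAt ℂ p)_p`.  Equivalently it is the value of
the cotangent vector `α_p` on the generator `1` of Mathlib's `TangentSpace 𝓘(ℂ) p = ℂ`.
Values at poles carry no meaning. -/
abbrev OneForm (S : Type*) : Type _ := S → ℂ

/-- A bidifferential on `S × S`; `B p q` is the coefficient at `(p, q)` with respect to
`d(chartAt ℂ p) ⊗ d(chartAt ℂ q)`.  Values at poles carry no meaning. -/
abbrev BiDifferential (S : Type*) : Type _ := S → S → ℂ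

section Forms

variable {S : Type*} [TopologicalSpace S] [ChartedSpace ℂ S]

/-- The velocity at `t` of a curve `c : 𝕜 → S` (`𝕜 = ℝ` for a path, `𝕜 = ℂ` for the inverse of a
local coordinate), read in the preferred local coordinate at `c t`. -/
def velocity {𝕜 : Type*} [NontriviallyNormedField 𝕜] [NormedSpace 𝕜 ℂ] (c : 𝕜 → S) (t : 𝕜) : ℂ :=
  deriv (fun s => chartAt ℂ (c t) (c s)) t

/-- The coefficient of `dt` in the pullback `c^* α`. -/
def OneForm.pullback {𝕜 : Type*} [NontriviallyNormedField 𝕜] [NormedSpace 𝕜 ℂ]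
    (α : OneForm S) (c : 𝕜 → S) (t : 𝕜) : ℂ :=
  α (c t) * velocity c t

/-- The coefficient of `dw ⊗ dv` in the expression of a bidifferential in the local coordinates
`φ` (first variable) and `ψ` (second variable). -/
def BiDifferential.coeff (B : BiDifferential S) (φ ψ : OpenPartialHomeomorph S ℂ) (w v : ℂ) : ℂ :=
  B (φ.symm w) (ψ.symm v) * velocity φ.symm w * velocity ψ.symm v

/-- The differential `df` of a function. -/
def differential (f : S → ℂ) : OneForm S := fun p =>
  deriv (f ∘ (chartAt ℂ p).symm) (chartAt ℂ p p)

/-- The fundamental bidifferential of the second kind on `S` (Bergman kernel): a symmetric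
bidifferential, holomorphic off the diagonal, with expansion
`dw dv / (w - v)^2 + (holomorphic)` near the diagonal.  A choice of `𝒜`-cycles singles out
the one among these whose `𝒜`-periods vanish; no such choice is imposed here. -/
structure IsBergmanKernel (B : BiDifferential S) : Prop where
  symm : ∀ p q, p ≠ q → B p q = B q p
  holomorphic_off_diag : ∀ p q, p ≠ q →
    AnalyticAt ℂ (fun wv : ℂ × ℂ => B.coeff (chartAt ℂ p) (chartAt ℂ q) wv.1 wv.2)
      (chartAt ℂ p p, chartAt ℂ q q)
  double_pole : ∀ p, ∃ h : ℂ × ℂ → ℂ, AnalyticAt ℂ h (chartAt ℂ p p, chartAt ℂ p p) ∧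
    ∀ᶠ wv in 𝓝 (chartAt ℂ p p, chartAt ℂ p p), wv.1 ≠ wv.2 →
      B.coeff (chartAt ℂ p) (chartAt ℂ p) wv.1 wv.2 = 1 / (wv.1 - wv.2) ^ 2 + h wv

end Forms

/-- The residue at `a` of a function that is holomorphic in a punctured neighbourhood of `a`
(for such functions the circle integrals are independent of the small radius `r`). -/
def residue (f : ℂ → ℂ) (a : ℂ) : ℂ :=
  limUnder (𝓝[>] (0 : ℝ)) fun r => (2 * (Real.pi : ℂ) * Complex.I)⁻¹ * ∮ w in C(a, r), f w

/-! ### Spectral curves -/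

section Curve

variable (S : Type*) [TopologicalSpace S] [ChartedSpace ℂ S]

/-- A spectral curve `(S, x, y)` with `N` critical points, for a meromorphic function `x`. -/
structure SpectralCurve (N : ℕ) where
  /-- the boundary points -/
  bdry : Set S
  finite_bdry : bdry.Finite
  /-- the function `x` (its values at the boundary points carry no meaning) -/
  x : S → ℂ
  holomorphic_x : ∀ p, p ∉ bdry → ContMDiffAt 𝓘(ℂ) 𝓘(ℂ) ω x p
  pole_x : ∀ b ∈ bdry,
    MeromorphicAt (x ∘ (chartAt ℂ b).symm) (chartAt ℂ b b) ∧
      meromorphicOrderAt (x ∘ (chartAt ℂ b).symm) (chartAt ℂ b b) < 0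
  /-- the critical points: the zeros of `dx`, all of them simple -/
  crit : Fin N → S
  crit_injective : Function.Injective crit
  mem_range_crit_iff : ∀ p, p ∈ range crit ↔ p ∉ bdry ∧ differential x p = 0
  simple_zero : ∀ β,
    deriv (deriv (x ∘ (chartAt ℂ (crit β)).symm)) (chartAt ℂ (crit β) (crit β)) ≠ 0
  /-- the function `y`, only used near the critical points -/
  y : S → ℂ
  holomorphic_y : ∀ β, ContMDiffAt 𝓘(ℂ) 𝓘(ℂ) ω y (crit β)
  dy_ne_zero : ∀ β, differential y (crit β) ≠ 0

variable {S} {N : ℕ}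

/-- Local Airy coordinates `η^β` around the critical points: `x = x^β + (η^β)^2 / 2`. -/
structure AiryCoordinates (C : SpectralCurve S N) where
  chart : Fin N → OpenPartialHomeomorph S ℂ
  mem_maximalAtlas : ∀ β, chart β ∈ IsManifold.maximalAtlas 𝓘(ℂ) ω S
  mem_source : ∀ β, C.crit β ∈ (chart β).source
  chart_crit : ∀ β, chart β (C.crit β) = 0
  x_eq : ∀ β, ∀ p ∈ (chart β).source, C.x p = C.x (C.crit β) + (chart β p) ^ 2 / 2

namespace SpectralCurve

/-- The operator `-d ∘ (1/dx)` on one-forms. -/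
def descend (C : SpectralCurve S N) (α : OneForm S) : OneForm S :=
  -differential fun p => α p / differential C.x p

/-- The one-form `dζ^β(z) = - Res_{z' = z^β} B(z', z) / η^β(z')`. -/
def dzetaZero {C : SpectralCurve S N} (A : AiryCoordinates C) (B : BiDifferential S)
    (β : Fin N) : OneForm S := fun p =>
  -residue (fun t => OneForm.pullback (fun q => B q p) (A.chart β).symm t / t) 0

/-- The one-forms `dζ_k^β = (-d ∘ (1/dx))^k dζ^β`. -/
def dzeta {C : SpectralCurve S N} (A : AiryCoordinates C) (B : BiDifferential S)
    (k : ℕ) (β : Fin N) : OneForm S :=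
  C.descend^[k] (dzetaZero A B β)

/-! ### Lefschetz thimbles and the `R`-matrix -/

/-- A Lefschetz thimble `𝔏_γ`: a path in `S` through the critical point `z^γ` and no other one,
along which `x - x^γ` is real and nonnegative.  It is parametrized by `t ∈ dom` with
`x(path t) = x^γ + t^2/2`, where `dom` is a closed interval (bounded or not) around `0`, so `t` is
the continuation of the Airy coordinate along the path; this also fixes the orientation.
`rad` is the radius of the disc in the Airy coordinate in which the path is indented at `z^γ`
when the integrand has a pole there. -/
structure LefschetzThimble {C : SpectralCurve S N} (A : AiryCoordinates C) (γ : Fin N) where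
  dom : Set ℝ
  isClosed_dom : IsClosed dom
  ordConnected_dom : dom.OrdConnected
  path : ℝ → S
  continuousOn_path : ContinuousOn path dom
  notMem_bdry : ∀ t ∈ dom, path t ∉ C.bdry
  notMem_crit : ∀ t ∈ dom, t ≠ 0 → path t ∉ range C.crit
  x_path : ∀ t ∈ dom, C.x (path t) = C.x (C.crit γ) + (t : ℂ) ^ 2 / 2
  rad : ℝ
  rad_pos : 0 < rad
  closedBall_subset : Metric.closedBall (0 : ℂ) rad ⊆ (A.chart γ).target
  Icc_subset : Icc (-rad) rad ⊆ dom
  path_eq : ∀ t ∈ Icc (-rad) rad, path t = (A.chart γ).symm (t : ℂ)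

/-- The integral `∫_{𝔏_γ} e^{-x/u} α`.  Since `α` may have a pole (without residue) at `z^γ`, the
segment `[-rad, rad]` of the path is replaced by the upper half of the circle of radius `rad` in
the Airy coordinate, run through from `-rad` to `rad`. -/
def LefschetzThimble.integral {C : SpectralCurve S N} {A : AiryCoordinates C} {γ : Fin N}
    (L : LefschetzThimble A γ) (α : OneForm S) (u : ℝ) : ℂ :=
  (∫ t in L.dom \ Icc (-L.rad) L.rad,
      Complex.exp (-C.x (L.path t) / u) * α.pullback L.path t) +
    ∫ θ in Real.pi..0,
      Complex.exp (-C.x ((A.chart γ).symm (circleMap 0 L.rad θ)) / u) *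
        α.pullback (fun θ' : ℝ => (A.chart γ).symm (circleMap 0 L.rad θ')) θ

/-- `R(u) = ∑_k R_k u^k`, an `End(H)`-valued formal power series written as matrices in the
normalized canonical basis `ē_β` (entry `R k β γ` is `η(R_k ē_γ, ē_β)`), is the `R`-matrix of the
spectral curve: as `u → 0+`, `(u / √(2πu)) ∫_{𝔏_γ} e^{-x/u} dζ^β` has the asymptotic expansion
`e^{-x^γ/u} η(R(-u) ē_γ, ē_β)`. -/
def IsRMatrix {C : SpectralCurve S N} {A : AiryCoordinates C} (B : BiDifferential S)
    (L : ∀ γ, LefschetzThimble A γ) (R : ℕ → Matrix (Fin N) (Fin N) ℂ) : Prop :=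
  ∀ (β γ : Fin N) (n : ℕ),
    (fun u : ℝ =>
      Complex.exp (C.x (C.crit γ) / u) *
          (((u / √(2 * Real.pi * u) : ℝ) : ℂ) * (L γ).integral (dzetaZero A B β) u) -
        ∑ k ∈ Finset.range n, R k β γ * (-(u : ℂ)) ^ k)
      =O[𝓝[>] (0 : ℝ)] fun u : ℝ => u ^ n

/-! ### The Euler vector, the operator `μ`, homogeneity -/

/-- `Δ_β^{-1/2}`, the derivative of `y` with respect to the Airy coordinate at `z^β`; the canonical
idempotent is `e_β = Δ_β^{-1/2} ē_β`. -/
def invSqrtDelta {C : SpectralCurve S N} (A : AiryCoordinates C) (β : Fin N) : ℂ :=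
  deriv (C.y ∘ (A.chart β).symm) 0

/-- The canonical basis vector `e_β` of the state space `H = ℂ^N`, whose standard basis is the
normalized canonical basis `ē_β`. -/
def canonicalBasis {C : SpectralCurve S N} (A : AiryCoordinates C) (β : Fin N) : Fin N → ℂ :=
  invSqrtDelta A β • Pi.single β 1

/-- The quantum product `*` on `H`: `ē_β * ē_γ = δ_{βγ} Δ_β^{1/2} ē_β`, so that the `e_β` are
orthogonal idempotents. -/
def quantumMul {C : SpectralCurve S N} (A : AiryCoordinates C) :
    (Fin N → ℂ) →ₗ[ℂ] (Fin N → ℂ) →ₗ[ℂ] (Fin N → ℂ) :=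
  LinearMap.mk₂ ℂ (fun v w β => (invSqrtDelta A β)⁻¹ * v β * w β)
    (fun _ _ _ => by ext; simp; ring) (fun _ _ _ => by ext; simp; ring)
    (fun _ _ _ => by ext; simp; ring) (fun _ _ _ => by ext; simp; ring)

/-- `E_0 = ∑_β x^β e_β`. -/
def eulerVector {C : SpectralCurve S N} (A : AiryCoordinates C) : Fin N → ℂ :=
  ∑ β, C.x (C.crit β) • canonicalBasis A β

/-- The operator `E_0*` of quantum multiplication by `E_0`, as a matrix in the basis `ē_β`. -/
def eulerMul {C : SpectralCurve S N} (A : AiryCoordinates C) : Matrix (Fin N) (Fin N) ℂ :=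
  LinearMap.toMatrix' (quantumMul A (eulerVector A))

/-- `μ = [R_1, E_0*]`. -/
def mu {C : SpectralCurve S N} (A : AiryCoordinates C) (R : ℕ → Matrix (Fin N) (Fin N) ℂ) :
    Matrix (Fin N) (Fin N) ℂ :=
  ⁅R 1, eulerMul A⁆

/-- The spectral curve with `R`-matrix `R` is homogeneous:
`(x - x^β) dζ_1^β = ∑_γ (μ + 3/2)^β_γ dζ_0^γ` for every `β`, as meromorphic one-forms on `S`,
that is, away from the boundary points and the critical points. -/
def IsHomogeneous {C : SpectralCurve S N} (A : AiryCoordinates C) (B : BiDifferential S)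
    (R : ℕ → Matrix (Fin N) (Fin N) ℂ) : Prop :=
  ∀ (β : Fin N) (p : S), p ∉ C.bdry → p ∉ range C.crit →
    (C.x p - C.x (C.crit β)) * dzeta A B 1 β p =
      ∑ γ, (mu A R + (3 / 2 : ℂ) • (1 : Matrix (Fin N) (Fin N) ℂ)) β γ * dzeta A B 0 γ p

end SpectralCurve

end Curve

end

/-! ### The operator `f ↦ ((f - f 0) / t)'` on germs at the origin. -/

section DerivDslope

/-! Everything is read off in the Airy coordinate `t` at a critical point `z^γ`. There `dx = t dt`,
and `dζ^β = (-δ_{βγ} / t^2 + h_{βγ}(t)) dt` with `h_{βγ}` holomorphic. Write `T f = ((f - f 0) /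
t)'`, which is `derivDslope`, and `D = x^γ - x^β`.

The operator `T` is integration by parts against the Gaussian: up to terms flat in `u`, `∫
e^{-t^2/2u} f = f 0 ∫ e^{-t^2/2u} + u ∫ e^{-t^2/2u} T f`. Iterating gives Watson's lemma with
coefficients `T^k f (0)` (`isBigO_gaussIntegral_sub`). The double pole integrates by parts to `δ/u`
times the Gaussian integral, and the part of the thimble outside the indentation is flat because
`dζ^β / dx` is bounded there (`LefschetzThimble.isFlat_far`). Hence `R_0 = 1` and `(R_{k+1})_{βγ} =
(-1)^{k+1} T^k h_{βγ} (0)`; coefficients of an asymptotic expansion being unique, this is the only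
`R`-matrix.

Since `E_0*` is diagonal with entries `x^β`, commutation with it multiplies the entry `βγ` by `D`.
The defect of homogeneity, `(x - x^β) dζ_1^β - ∑ (μ + 3/2) dζ_0`, loses its polar part at every
critical point precisely because of the value of `μ` and the constant `3/2`. Divided by `dx` it
equals `P / t` with `P = -D T h_{βγ} - t h_{βγ}' / 2 - ∑_δ (μ + 1)_{βδ} h_{δγ}`
(`defectForm_div_airy`).

If the curve is homogeneous then `P = 0`. Applying `T^k`, with the commutation rule `T (t f') = t (T
f)' + 2 T f`, and evaluating at `0` gives the recursion at `m = k + 1`; the case `m = 0` is the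
definition of `μ`. Conversely, the recursion at `m = 1` alone says `P(0) = 0` at each critical
point. Then the defect over `dx` has only removable singularities, so by Liouville's theorem it is
constant, and it vanishes at the poles of `x`, of which there is at least one
(`defectForm_eq_zero`). -/

/-- The operator `f ↦ ((f - f 0) / t)'` on functions holomorphic near `0`. -/
noncomputable def derivDslope (f : ℂ → ℂ) : ℂ → ℂ := deriv (dslope f 0)

theorem DifferentiableOn.derivDslope {f : ℂ → ℂ} {U : Set ℂ} (hU : IsOpen U) (h0 : (0 : ℂ) ∈ U)
    (hf : DifferentiableOn ℂ f U) : DifferentiableOn ℂ (derivDslope f) U :=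
  ((Complex.differentiableOn_dslope (hU.mem_nhds h0)).2 hf).deriv hU

theorem AnalyticAt.dslope_zero {f : ℂ → ℂ} (hf : AnalyticAt ℂ f 0) :
    AnalyticAt ℂ (dslope f 0) 0 := by
  obtain ⟨U, hU, hfU⟩ := (Complex.analyticAt_iff_eventually_differentiableAt.1 hf).exists_mem
  rw [Complex.analyticAt_iff_eventually_differentiableAt]
  have h1 : DifferentiableOn ℂ f (interior U) := fun z hz =>
    (hfU z (interior_subset hz)).differentiableWithinAt
  have h2 := (Complex.differentiableOn_dslope (interior_mem_nhds.2 hU)).2 h1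
  filter_upwards [interior_mem_nhds.2 hU] with z hz
  exact h2.differentiableAt (isOpen_interior.mem_nhds hz)

theorem AnalyticAt.derivDslope {f : ℂ → ℂ} (hf : AnalyticAt ℂ f 0) :
    AnalyticAt ℂ (derivDslope f) 0 := hf.dslope_zero.deriv

theorem AnalyticAt.iterate_derivDslope {f : ℂ → ℂ} (hf : AnalyticAt ℂ f 0) (k : ℕ) :
    AnalyticAt ℂ (_root_.derivDslope^[k] f) 0 := by
  induction k with
  | zero => exact hf
  | succ k ih => rw [Function.iterate_succ_apply']; exact ih.derivDslope

theorem eq_add_mul_dslope (f : ℂ → ℂ) (t : ℂ) : f t = f 0 + t * dslope f 0 t := by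
  have := sub_smul_dslope f 0 t
  simp only [sub_zero, smul_eq_mul] at this
  rw [this]; ring

theorem dslope_zero_of_ne (f : ℂ → ℂ) {t : ℂ} (ht : t ≠ 0) : dslope f 0 t = (f t - f 0) / t := by
  rw [dslope_of_ne _ ht, slope_def_field, sub_zero]

/-- `dslope f 0` is the only function continuous at `0` with `f = f 0 + t * k`. -/
theorem dslope_zero_eventuallyEq {f k : ℂ → ℂ} (hk : AnalyticAt ℂ k 0)
    (h : ∀ᶠ t in 𝓝 0, f t = f 0 + t * k t) : dslope f 0 =ᶠ[𝓝 0] k := by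
  have hd : deriv f 0 = k 0 := by
    have h1 : HasDerivAt (fun t => f 0 + t * k t) (1 * k 0 + 0 * deriv k 0) 0 :=
      ((hasDerivAt_id (0 : ℂ)).mul hk.differentiableAt.hasDerivAt).const_add _
    rw [EventuallyEq.deriv_eq h, h1.deriv]; ring
  filter_upwards [h] with t ht
  rcases eq_or_ne t 0 with rfl | hne
  · rw [dslope_same, hd]
  · rw [dslope_zero_of_ne f hne, ht]; field_simp; ring

/-- The algebraic rules for `derivDslope` all reduce to this: any analytic `k` with `f = f 0 + t k`
must be the difference quotient, so it suffices to exhibit one. -/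
theorem derivDslope_eventuallyEq {f k : ℂ → ℂ} (hk : AnalyticAt ℂ k 0)
    (h : ∀ᶠ t in 𝓝 0, f t = f 0 + t * k t) : derivDslope f =ᶠ[𝓝 0] deriv k :=
  (dslope_zero_eventuallyEq hk h).deriv

theorem Filter.EventuallyEq.derivDslope {f g : ℂ → ℂ} (hg : AnalyticAt ℂ g 0)
    (h : f =ᶠ[𝓝 0] g) : derivDslope f =ᶠ[𝓝 0] derivDslope g := by
  refine derivDslope_eventuallyEq hg.dslope_zero ?_
  filter_upwards [h] with t ht
  rw [ht, h.self_of_nhds]; exact eq_add_mul_dslope g t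

theorem derivDslope_add {f g : ℂ → ℂ} (hf : AnalyticAt ℂ f 0) (hg : AnalyticAt ℂ g 0) :
    derivDslope (fun t => f t + g t) =ᶠ[𝓝 0] fun t => derivDslope f t + derivDslope g t := by
  have h := derivDslope_eventuallyEq (f := fun t => f t + g t)
    (hf.dslope_zero.add hg.dslope_zero) (Eventually.of_forall fun t => by
      simp only [Pi.add_apply]; rw [eq_add_mul_dslope f t, eq_add_mul_dslope g t]; ring)
  filter_upwards [h, hf.dslope_zero.eventually_analyticAt, hg.dslope_zero.eventually_analyticAt]
    with t h1 h2 h3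
  rw [h1, deriv_add h2.differentiableAt h3.differentiableAt]; rfl

theorem derivDslope_const_mul {f : ℂ → ℂ} (c : ℂ) (hf : AnalyticAt ℂ f 0) :
    derivDslope (fun t => c * f t) =ᶠ[𝓝 0] fun t => c * derivDslope f t := by
  have h := derivDslope_eventuallyEq (f := fun t => c * f t) (k := fun t => c * dslope f 0 t)
    (analyticAt_const.mul hf.dslope_zero) (Eventually.of_forall fun t => by
      rw [eq_add_mul_dslope f t]; ring)
  filter_upwards [h, hf.dslope_zero.eventually_analyticAt] with t h1 h2
  rw [h1, deriv_const_mul _ h2.differentiableAt]; rfl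

theorem derivDslope_sum {ι : Type*} (s : Finset ι) (c : ι → ℂ) (f : ι → ℂ → ℂ)
    (hf : ∀ i, AnalyticAt ℂ (f i) 0) :
    derivDslope (fun t => ∑ i ∈ s, c i * f i t) =ᶠ[𝓝 0]
      fun t => ∑ i ∈ s, c i * derivDslope (f i) t := by
  classical
  induction s using Finset.induction_on with
  | empty =>
    refine (derivDslope_eventuallyEq (k := fun _ => 0) analyticAt_const ?_).trans ?_
    · simp
    · simp
  | insert a s ha ih =>
    have h1 : AnalyticAt ℂ (fun t => ∑ i ∈ s, c i * f i t) 0 :=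
      Finset.analyticAt_fun_sum _ fun i _ => analyticAt_const.mul (hf i)
    simp only [Finset.sum_insert ha]
    refine (derivDslope_add (analyticAt_const.mul (hf a)) h1).trans ?_
    filter_upwards [ih, derivDslope_const_mul (c a) (hf a)] with t h2 h3
    rw [h2]; exact congrArg (· + _) h3

/-- The commutation relation with the Euler operator `t d/dt`. -/
theorem derivDslope_mul_deriv {f : ℂ → ℂ} (hf : AnalyticAt ℂ f 0) :
    derivDslope (fun t => t * deriv f t) =ᶠ[𝓝 0]
      fun t => t * deriv (derivDslope f) t + 2 * derivDslope f t := by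
  have hk := hf.dslope_zero
  have h1 : ∀ᶠ t in 𝓝 (0 : ℂ), deriv f t = dslope f 0 t + t * derivDslope f t := by
    filter_upwards [hk.eventually_analyticAt] with t ht
    have h2 : HasDerivAt (fun t => f 0 + t * dslope f 0 t)
        (1 * dslope f 0 t + t * deriv (dslope f 0) t) t :=
      ((hasDerivAt_id t).mul ht.differentiableAt.hasDerivAt).const_add _
    have h3 : f = fun t => f 0 + t * dslope f 0 t := funext (eq_add_mul_dslope f)
    rw [h3, h2.deriv, one_mul, ← h3]; rfl
  have h4 := derivDslope_eventuallyEq (f := fun t => t * deriv f t)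
    (k := fun t => dslope f 0 t + t * derivDslope f t)
    (hk.add (analyticAt_id.mul hf.derivDslope)) (by
      filter_upwards [h1] with t ht
      rw [ht]; simp)
  filter_upwards [h4, hk.eventually_analyticAt, hf.derivDslope.eventually_analyticAt]
      with t h5 h6 h7
  have h8 : HasDerivAt (fun t => dslope f 0 t + t * derivDslope f t)
      (deriv (dslope f 0) t + (1 * derivDslope f t + t * deriv (derivDslope f) t)) t :=
    h6.differentiableAt.hasDerivAt.add ((hasDerivAt_id t).mul h7.differentiableAt.hasDerivAt)
  rw [h5, h8.deriv]
  change derivDslope f t + _ = _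
  ring

theorem derivDslope_of_ne {f : ℂ → ℂ} {t : ℂ} (ht : t ≠ 0) (hf : DifferentiableAt ℂ f t) :
    derivDslope f t = deriv f t / t - (f t - f 0) / t ^ 2 := by
  have h1 : dslope f 0 =ᶠ[𝓝 t] fun s => (f s - f 0) / s := by
    filter_upwards [isOpen_ne.mem_nhds ht] with s hs using dslope_zero_of_ne f hs
  have h2 : HasDerivAt (fun s => (f s - f 0) / s) ((deriv f t * t - (f t - f 0) * 1) / t ^ 2) t :=
    (hf.hasDerivAt.sub_const _).div (hasDerivAt_id' t) ht
  rw [derivDslope, h1.deriv_eq, h2.deriv]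
  field_simp

/-- A first-order equation `-D (derivDslope f) = t f' / 2 + ∑ c_i g_i` yields a recursion for the
values at `0` of the iterates of `derivDslope`. -/
theorem iterate_derivDslope_recursion {ι : Type*} [Fintype ι] {f : ℂ → ℂ} {g : ι → ℂ → ℂ}
    (hf : AnalyticAt ℂ f 0) (hg : ∀ i, AnalyticAt ℂ (g i) 0) (D : ℂ) (c : ι → ℂ)
    (h : ∀ᶠ t in 𝓝 0, -D * derivDslope f t = t * deriv f t / 2 + ∑ i, c i * g i t) (k : ℕ) :
    -D * derivDslope^[k + 1] f 0 =
      k * derivDslope^[k] f 0 + ∑ i, c i * derivDslope^[k] (g i) 0 := by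
  -- The induction needs the identity of germs, since `derivDslope` cannot be applied to a value at
  -- `0`. Commuting it past `t d/dt` contributes `1/2 * 2 = 1` at each stage, whence the factor `k`;
  -- the Euler term itself dies at `t = 0`.
  have key : ∀ k : ℕ, ∀ᶠ t in 𝓝 (0 : ℂ), -D * derivDslope^[k + 1] f t =
      1 / 2 * (t * deriv (derivDslope^[k] f) t) +
        (k * derivDslope^[k] f t + ∑ i, c i * derivDslope^[k] (g i) t) := by
    intro k
    induction k with
    | zero =>
      filter_upwards [h] with t ht
      simp only [zero_add, Function.iterate_one, Function.iterate_zero, id, ht]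
      push_cast; ring
    | succ k ih =>
      have a1 := hf.iterate_derivDslope k
      have a2 := hf.iterate_derivDslope (k + 1)
      have a3 := fun i => (hg i).iterate_derivDslope k
      have a4 : AnalyticAt ℂ (fun t => ∑ i, c i * derivDslope^[k] (g i) t) 0 :=
        Finset.analyticAt_fun_sum _ fun i _ => analyticAt_const.mul (a3 i)
      have a5 : AnalyticAt ℂ (fun t => t * deriv (derivDslope^[k] f) t) 0 :=
        analyticAt_id.mul a1.deriv
      have a6 : AnalyticAt ℂ (fun t => (k : ℂ) * derivDslope^[k] f t) 0 := analyticAt_const.mul a1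
      have e1 := (derivDslope_const_mul (-D) a2).symm.trans <|
        (Filter.EventuallyEq.derivDslope ((analyticAt_const.mul a5).add (a6.add a4)) ih).trans <|
        derivDslope_add (analyticAt_const.mul a5) (a6.add a4)
      filter_upwards [e1, derivDslope_const_mul (1 / 2) a5, derivDslope_mul_deriv a1,
        derivDslope_add a6 a4, derivDslope_const_mul (k : ℂ) a1,
        derivDslope_sum Finset.univ c _ a3] with t b1 b2 b3 b4 b5 b6
      rw [Function.iterate_succ_apply' _ (k + 1)]
      simp only [Function.iterate_succ_apply' _ k] at b1 ⊢
      rw [b1]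
      erw [b2, b3, b4]
      rw [b5, b6]
      push_cast; ring
  have := (key k).self_of_nhds
  rw [this]; ring

end DerivDslope

/-! ### Asymptotic expansions of Gaussian integrals. -/

section Laplace

/-- Functions that vanish to all orders as `u → 0+`. -/
def IsFlat (g : ℝ → ℂ) : Prop := ∀ n : ℕ, g =O[𝓝[>] (0 : ℝ)] fun u : ℝ => u ^ n

theorem eventually_pos_lt_one : ∀ᶠ u : ℝ in 𝓝[>] (0 : ℝ), 0 < u ∧ u < 1 :=
  Ioo_mem_nhdsGT one_pos

theorem isBigO_pow_of_le {m n : ℕ} (h : m ≤ n) :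
    (fun u : ℝ => u ^ n) =O[𝓝[>] (0 : ℝ)] fun u : ℝ => u ^ m := by
  refine Asymptotics.IsBigO.of_bound 1 ?_
  filter_upwards [eventually_pos_lt_one] with u hu
  rw [one_mul, norm_pow, norm_pow]
  exact pow_le_pow_of_le_one (norm_nonneg _) (by rw [Real.norm_of_nonneg hu.1.le]; exact hu.2.le) h

theorem IsFlat.add {f g : ℝ → ℂ} (hf : IsFlat f) (hg : IsFlat g) : IsFlat fun u => f u + g u :=
  fun n => (hf n).add (hg n)

theorem IsFlat.const_mul {f : ℝ → ℂ} (hf : IsFlat f) (c : ℂ) : IsFlat fun u => c * f u :=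
  fun n => (hf n).const_mul_left c

/-- A function bounded by a multiple of `exp (-κ / u)` is flat. -/
theorem IsFlat.of_norm_le {g : ℝ → ℂ} {κ M : ℝ} (hκ : 0 < κ)
    (h : ∀ u : ℝ, 0 < u → u < 1 → ‖g u‖ ≤ M * Real.exp (-κ / u)) : IsFlat g := by
  intro n
  -- The constant comes from keeping one term of the exponential series, `(κ/u)^n / n! ≤ e^{κ/u}`.
  refine Asymptotics.IsBigO.of_bound (|M| * (n.factorial / κ ^ n)) ?_
  filter_upwards [eventually_pos_lt_one] with u hu
  have hu0 := hu.1
  have h1 : (κ / u) ^ n / n.factorial ≤ Real.exp (κ / u) :=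
    Real.pow_div_factorial_le_exp _ (by positivity) n
  have h2 : Real.exp (-κ / u) ≤ n.factorial / κ ^ n * u ^ n := by
    rw [neg_div, Real.exp_neg]
    calc (Real.exp (κ / u))⁻¹ ≤ ((κ / u) ^ n / n.factorial)⁻¹ :=
          inv_anti₀ (by positivity) h1
      _ = _ := by rw [div_pow]; field_simp
  calc ‖g u‖ ≤ M * Real.exp (-κ / u) := h u hu.1 hu.2
    _ ≤ |M| * (n.factorial / κ ^ n * u ^ n) := by
        gcongr; exact le_abs_self M
    _ = _ := by rw [Real.norm_of_nonneg (by positivity)]; ring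

/-- A flat function remains flat after multiplication by a function of polynomial growth. -/
theorem IsFlat.mul {f g : ℝ → ℂ} (hf : IsFlat f) (m : ℕ)
    (hg : (fun u : ℝ => (u : ℂ) ^ m * g u) =O[𝓝[>] (0 : ℝ)] fun _ => (1 : ℝ)) :
    IsFlat fun u => g u * f u := by
  intro n
  obtain ⟨a, ha⟩ := (hf (n + m)).bound
  obtain ⟨b, hb⟩ := hg.bound
  refine Asymptotics.IsBigO.of_bound (|b| * |a|) ?_
  filter_upwards [ha, hb, eventually_pos_lt_one] with u h1 h2 h3
  have hu := h3.1
  rw [norm_mul, norm_pow, Complex.norm_real, Real.norm_of_nonneg hu.le, norm_one, mul_one] at h2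
  rw [norm_pow, Real.norm_of_nonneg hu.le] at h1 ⊢
  rw [norm_mul]
  have hum : 0 < u ^ m := by positivity
  have h4 : ‖g u‖ ≤ |b| / u ^ m := by
    rw [le_div_iff₀ hum, mul_comm]; exact h2.trans (le_abs_self b)
  calc ‖g u‖ * ‖f u‖ ≤ (|b| / u ^ m) * (|a| * u ^ (n + m)) := by
        gcongr; exact h1.trans (by gcongr; exact le_abs_self a)
    _ = |b| * |a| * u ^ n := by rw [pow_add]; field_simp

/-- The coefficients of an asymptotic expansion are determined by it. -/
theorem eq_zero_of_isBigO_sum (n : ℕ) (c : ℕ → ℂ)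
    (h : (fun u : ℝ => ∑ k ∈ Finset.range n, c k * (-(u : ℂ)) ^ k)
      =O[𝓝[>] (0 : ℝ)] fun u : ℝ => u ^ n) : ∀ k < n, c k = 0 := by
  induction n with
  | zero => simp
  | succ n ih =>
    have h1 : (fun u : ℝ => c n * (-(u : ℂ)) ^ n) =O[𝓝[>] (0 : ℝ)] fun u : ℝ => u ^ n := by
      refine Asymptotics.IsBigO.of_bound ‖c n‖ (Eventually.of_forall fun u => ?_)
      simp
    have h2 : ∀ k < n, c k = 0 := by
      refine ih (((h.trans (isBigO_pow_of_le n.le_succ)).sub h1).congr_left fun u => ?_)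
      rw [Finset.sum_range_succ]; ring
    -- Only the top term is left; dividing the bound by `u ^ n` gives `‖c n‖ ≤ a u`, which tends to
    -- zero.
    have h3 : c n = 0 := by
      obtain ⟨a, ha⟩ := h.bound
      have h4 : ∀ᶠ u : ℝ in 𝓝[>] (0 : ℝ), ‖c n‖ ≤ a * u := by
        filter_upwards [ha, eventually_pos_lt_one] with u hu hu'
        rw [Finset.sum_range_succ, Finset.sum_eq_zero (fun k hk => by
          rw [h2 k (Finset.mem_range.1 hk), zero_mul]), zero_add, norm_mul, norm_pow, norm_neg,
          Complex.norm_real, norm_pow, Real.norm_of_nonneg hu'.1.le, pow_succ] at hu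
        have : 0 < u ^ n := pow_pos hu'.1 n
        refine le_of_mul_le_mul_right ?_ this
        linarith
      have h5 : Tendsto (fun u : ℝ => a * u) (𝓝[>] 0) (𝓝 0) := by
        have : Tendsto (fun u : ℝ => a * u) (𝓝 0) (𝓝 (a * 0)) := tendsto_id.const_mul a
        rw [mul_zero] at this
        exact this.mono_left nhdsWithin_le_nhds
      exact norm_le_zero_iff.1 (ge_of_tendsto h5 h4)
    intro k hk
    rcases Nat.lt_succ_iff_lt_or_eq.1 hk with h6 | rfl
    exacts [h2 k h6, h3]

/-- The Gaussian factor `exp (-t^2 / (2 u))`. -/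
noncomputable def gaussFactor (u : ℝ) (t : ℂ) : ℂ := Complex.exp (-t ^ 2 / (2 * u))

theorem norm_gaussFactor_ofReal (u t : ℝ) :
    ‖gaussFactor u t‖ = Real.exp (-(1 / (2 * u)) * t ^ 2) := by
  rw [gaussFactor, Complex.norm_exp]
  congr 1
  rw [show (-(t : ℂ) ^ 2 / (2 * u)) = ((-t ^ 2 / (2 * u) : ℝ) : ℂ) by push_cast; ring,
    Complex.ofReal_re]
  ring

theorem hasDerivAt_gaussFactor (u : ℝ) (t : ℂ) :
    HasDerivAt (gaussFactor u) (-t / u * gaussFactor u t) t := by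
  have h1 : HasDerivAt (fun t : ℂ => -t ^ 2 / (2 * u)) (-(2 * t) / (2 * u)) t := by
    have := ((hasDerivAt_pow 2 t).neg).div_const (2 * (u : ℂ))
    simpa using this
  refine h1.cexp.congr_deriv ?_
  rw [gaussFactor, mul_comm]
  congr 1
  rw [← mul_neg, mul_div_mul_left _ _ two_ne_zero]

/-- The Gaussian integral of `f` over `[-r, r]`. -/
noncomputable def gaussIntegral (r : ℝ) (f : ℂ → ℂ) (u : ℝ) : ℂ :=
  ∫ t in (-r)..r, gaussFactor u (t : ℂ) * f t

theorem integrable_far : MeasureTheory.Integrable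
    fun t : ℝ => (1 + |t|) * Real.exp (-(1 / 4) * t ^ 2) := by
  have h1 := integrable_exp_neg_mul_sq (b := 1 / 4) (by norm_num)
  have h2 := (integrable_mul_exp_neg_mul_sq (b := 1 / 4) (by norm_num)).norm
  refine (h1.add h2).congr (Eventually.of_forall fun t => ?_)
  simp only [Pi.add_apply, norm_mul, Real.norm_eq_abs, Real.abs_exp]
  ring

/-- The part of a Gaussian integral at distance at least `r` from the origin is flat. -/
theorem isFlat_setIntegral_far {r : ℝ} (hr : 0 < r) {s : Set ℝ} (hs : MeasurableSet s)
    {g : ℝ → ℝ → ℂ} {M : ℝ} (hM : 0 ≤ M)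
    (h : ∀ u : ℝ, 0 < u → ∀ᵐ t, t ∈ s → r ≤ |t| ∧
      ‖g u t‖ ≤ M * (1 + |t|) * Real.exp (-(1 / (2 * u)) * t ^ 2)) :
    IsFlat fun u => ∫ t in s, g u t := by
  -- The exponent `t^2 / 2u` is split into halves: one gives `e^{-r^2/4u}` because `|t| ≥ r`, the
  -- other is at least `t^2 / 4` because `u < 1` and keeps the integral convergent uniformly in `u`.
  refine IsFlat.of_norm_le (κ := r ^ 2 / 4)
    (M := M * ∫ t : ℝ, (1 + |t|) * Real.exp (-(1 / 4) * t ^ 2)) (by positivity) fun u hu hu1 => ?_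
  have hb : ∀ᵐ t ∂(MeasureTheory.volume.restrict s), ‖g u t‖ ≤
      M * Real.exp (-(r ^ 2 / 4) / u) * ((1 + |t|) * Real.exp (-(1 / 4) * t ^ 2)) := by
    rw [MeasureTheory.ae_restrict_iff' hs]
    filter_upwards [h u hu] with t ht hts
    obtain ⟨h1, h2⟩ := ht hts
    refine h2.trans ?_
    have h3 : r ^ 2 ≤ t ^ 2 := by rw [← sq_abs t]; gcongr
    have h4 : -(1 / (2 * u)) * t ^ 2 ≤ -(r ^ 2 / 4) / u + -(1 / 4) * t ^ 2 := by
      have e1 : -(1 / (2 * u)) * t ^ 2 = -(t ^ 2 / 4) / u + -(1 / 4) * (t ^ 2 / u) := by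
        field_simp; ring
      have e2 : t ^ 2 ≤ t ^ 2 / u := by
        rw [le_div_iff₀ hu]; nlinarith [sq_nonneg t]
      have e3 : r ^ 2 / 4 / u ≤ t ^ 2 / 4 / u := by gcongr
      rw [e1, neg_div, neg_div]; linarith
    calc M * (1 + |t|) * Real.exp (-(1 / (2 * u)) * t ^ 2)
        ≤ M * (1 + |t|) * Real.exp (-(r ^ 2 / 4) / u + -(1 / 4) * t ^ 2) := by gcongr
      _ = _ := by rw [Real.exp_add]; ring
  have hi := integrable_far.const_mul (M * Real.exp (-(r ^ 2 / 4) / u))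
  calc ‖∫ t in s, g u t‖ ≤ ∫ t in s, M * Real.exp (-(r ^ 2 / 4) / u) *
        ((1 + |t|) * Real.exp (-(1 / 4) * t ^ 2)) :=
        MeasureTheory.norm_integral_le_of_norm_le hi.integrableOn hb
    _ ≤ ∫ t, M * Real.exp (-(r ^ 2 / 4) / u) * ((1 + |t|) * Real.exp (-(1 / 4) * t ^ 2)) :=
        MeasureTheory.setIntegral_le_integral hi (Eventually.of_forall fun t => by positivity)
    _ = _ := by rw [MeasureTheory.integral_const_mul]; ring

theorem integral_gaussFactor {u : ℝ} (hu : 0 < u) :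
    ∫ t : ℝ, gaussFactor u (t : ℂ) = (√(2 * Real.pi * u) : ℝ) := by
  have h1 : ∀ t : ℝ, gaussFactor u (t : ℂ) = ((Real.exp (-(1 / (2 * u)) * t ^ 2) : ℝ) : ℂ) := by
    intro t
    rw [gaussFactor, Complex.ofReal_exp]
    congr 1; push_cast; ring
  simp_rw [h1]
  rw [integral_complex_ofReal, integral_gaussian]
  congr 2; field_simp

theorem integrable_gaussFactor {u : ℝ} (hu : 0 < u) :
    MeasureTheory.Integrable fun t : ℝ => gaussFactor u (t : ℂ) := by
  have h1 := integrable_exp_neg_mul_sq (b := 1 / (2 * u)) (by positivity)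
  refine h1.ofReal.congr (Eventually.of_forall fun t => ?_)
  change ((Real.exp (-(1 / (2 * u)) * t ^ 2) : ℝ) : ℂ) = gaussFactor u (t : ℂ)
  rw [gaussFactor, Complex.ofReal_exp]
  congr 1; push_cast; ring

/-- Truncating the Gaussian to `[-r, r]` discards only its tails, which are flat; the truncated
moment may therefore be replaced by `√(2πu)` in every expansion. -/
theorem isFlat_gaussIntegral_one_sub {r : ℝ} (hr : 0 < r) :
    IsFlat fun u => gaussIntegral r (fun _ => 1) u - (√(2 * Real.pi * u) : ℝ) := by
  have h := (isFlat_setIntegral_far hr (s := (Ioc (-r) r)ᶜ) measurableSet_Ioc.compl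
    (g := fun u t => gaussFactor u (t : ℂ)) zero_le_one (fun u hu => Eventually.of_forall
    fun t ht => by
      refine ⟨?_, ?_⟩
      · rw [le_abs]
        by_contra hcon
        push Not at hcon
        exact ht ⟨by linarith, hcon.1.le⟩
      · rw [norm_gaussFactor_ofReal]
        refine le_mul_of_one_le_left (Real.exp_nonneg _) ?_
        have := abs_nonneg t; linarith)).const_mul (-1)
  intro n
  refine (h n).congr' ?_ EventuallyEq.rfl
  filter_upwards [eventually_pos_lt_one] with u hu
  rw [gaussIntegral, ← integral_gaussFactor hu.1, intervalIntegral.integral_of_le (by linarith),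
    ← MeasureTheory.integral_add_compl (measurableSet_Ioc (a := -r) (b := r))
      (integrable_gaussFactor hu.1)]
  simp

theorem isBigO_gaussIntegral {r ρ : ℝ} (hr : 0 < r) (hρ : r < ρ) {f : ℂ → ℂ}
    (hf : DifferentiableOn ℂ f (Metric.ball 0 ρ)) :
    gaussIntegral r f =O[𝓝[>] (0 : ℝ)] fun u : ℝ => √(2 * Real.pi * u) := by
  have hc : ContinuousOn f (Metric.closedBall 0 r) :=
    hf.continuousOn.mono (Metric.closedBall_subset_ball hρ)
  obtain ⟨M, hM⟩ := (isCompact_closedBall (0 : ℂ) r).exists_bound_of_continuousOn hc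
  refine Asymptotics.IsBigO.of_bound M ?_
  have hM0 : 0 ≤ M := (norm_nonneg _).trans (hM 0 (Metric.mem_closedBall_self hr.le))
  filter_upwards [eventually_pos_lt_one] with u hu
  have hi := (integrable_exp_neg_mul_sq (b := 1 / (2 * u))
      (by have := hu.1; positivity)).const_mul M
  have hrr : -r ≤ r := by linarith
  rw [gaussIntegral, intervalIntegral.integral_of_le hrr]
  calc ‖∫ t in Ioc (-r) r, gaussFactor u (t : ℂ) * f t‖
      ≤ ∫ t in Ioc (-r) r, M * Real.exp (-(1 / (2 * u)) * t ^ 2) := by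
        refine MeasureTheory.norm_integral_le_of_norm_le hi.integrableOn ?_
        rw [MeasureTheory.ae_restrict_iff' measurableSet_Ioc]
        refine Eventually.of_forall fun t ht => ?_
        rw [norm_mul, norm_gaussFactor_ofReal, mul_comm]
        gcongr
        refine hM _ ?_
        rw [mem_closedBall_zero_iff, Complex.norm_real, Real.norm_eq_abs, abs_le]
        exact ⟨ht.1.le, ht.2⟩
    _ ≤ ∫ t, M * Real.exp (-(1 / (2 * u)) * t ^ 2) :=
        MeasureTheory.setIntegral_le_integral hi (Eventually.of_forall fun t => by positivity)
    _ = M * ‖√(2 * Real.pi * u)‖ := by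
        rw [MeasureTheory.integral_const_mul, integral_gaussian,
          Real.norm_of_nonneg (Real.sqrt_nonneg _)]
        have := hu.1
        congr 2; field_simp

/-- Integration by parts for Gaussian integrals. -/
theorem gaussIntegral_eq {r ρ u : ℝ} (hr : 0 < r) (hρ : r < ρ) (hu : 0 < u) {f : ℂ → ℂ}
    (hf : DifferentiableOn ℂ f (Metric.ball 0 ρ)) :
    gaussIntegral r f u = f 0 * gaussIntegral r (fun _ => 1) u +
      u * gaussIntegral r (derivDslope f) u -
        u * (gaussFactor u r * (dslope f 0 r - dslope f 0 (-r))) := by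
  have h0 : (0 : ℂ) ∈ Metric.ball (0 : ℂ) ρ := Metric.mem_ball_self (hr.trans hρ)
  have hk : DifferentiableOn ℂ (dslope f 0) (Metric.ball 0 ρ) :=
    (Complex.differentiableOn_dslope (Metric.isOpen_ball.mem_nhds h0)).2 hf
  have hT := hf.derivDslope Metric.isOpen_ball h0
  have huc : (u : ℂ) ≠ 0 := by exact_mod_cast hu.ne'
  have hmem : ∀ t ∈ uIcc (-r) r, (t : ℂ) ∈ Metric.ball (0 : ℂ) ρ := by
    intro t ht
    rw [uIcc_of_le (by linarith)] at ht
    rw [mem_ball_zero_iff, Complex.norm_real, Real.norm_eq_abs, abs_lt]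
    exact ⟨by linarith [ht.1], by linarith [ht.2]⟩
  have hcg : Continuous fun t : ℝ => gaussFactor u (t : ℂ) := by
    unfold gaussFactor; fun_prop
  have hcomp : ∀ {k : ℂ → ℂ}, DifferentiableOn ℂ k (Metric.ball 0 ρ) →
      ContinuousOn (fun t : ℝ => k (t : ℂ)) (uIcc (-r) r) := fun hk =>
    hk.continuousOn.comp Complex.continuous_ofReal.continuousOn hmem
  -- Since `(e^{-t^2/2u})' = -(t/u) e^{-t^2/2u}`, the product `-u e^{-t^2/2u} k`, with `k` the
  -- difference quotient of `f`, has derivative `e^{-t^2/2u} t k - u e^{-t^2/2u} k'`, and `k'` is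
  -- `derivDslope f`.
  have hd : ∀ t ∈ uIcc (-r) r, HasDerivAt
      (fun t : ℝ => -(u : ℂ) * (gaussFactor u (t : ℂ) * dslope f 0 t))
      (gaussFactor u (t : ℂ) * (t * dslope f 0 t) -
        u * (gaussFactor u (t : ℂ) * derivDslope f t)) t := by
    intro t ht
    have h1 : HasDerivAt (dslope f 0) (derivDslope f t) (t : ℂ) :=
      (hk.differentiableAt (Metric.isOpen_ball.mem_nhds (hmem t ht))).hasDerivAt
    have h2 := (((hasDerivAt_gaussFactor u t).mul h1).const_mul (-(u : ℂ))).comp_ofReal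
    refine h2.congr_deriv ?_
    field_simp
    ring
  have hi1 : IntervalIntegrable (fun t : ℝ => gaussFactor u (t : ℂ) * (t * dslope f 0 t))
      MeasureTheory.volume (-r) r :=
    (hcg.continuousOn.mul (Complex.continuous_ofReal.continuousOn.mul (hcomp
      hk))).intervalIntegrable
  have hi2 : IntervalIntegrable (fun t : ℝ => (u : ℂ) * (gaussFactor u (t : ℂ) * derivDslope f t))
      MeasureTheory.volume (-r) r :=
    (continuousOn_const.mul (hcg.continuousOn.mul (hcomp hT))).intervalIntegrable
  have hftc := intervalIntegral.integral_eq_sub_of_hasDerivAt hd (hi1.sub hi2)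
  rw [intervalIntegral.integral_sub hi1 hi2, intervalIntegral.integral_const_mul] at hftc
  have hi3 : IntervalIntegrable (fun t : ℝ => f 0 * (gaussFactor u (t : ℂ) * 1))
      MeasureTheory.volume (-r) r :=
    (continuous_const.mul (hcg.mul continuous_const)).intervalIntegrable _ _
  have hsplit : gaussIntegral r f u = f 0 * gaussIntegral r (fun _ => 1) u +
      ∫ t in (-r)..r, gaussFactor u (t : ℂ) * (t * dslope f 0 t) := by
    rw [gaussIntegral, gaussIntegral, ← intervalIntegral.integral_const_mul,
      ← intervalIntegral.integral_add hi3 hi1]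
    refine intervalIntegral.integral_congr fun t _ => ?_
    rw [eq_add_mul_dslope f t]; ring
  have hsym : gaussFactor u ((-r : ℝ) : ℂ) = gaussFactor u r := by
    simp [gaussFactor]
  rw [hsplit, eq_add_of_sub_eq hftc, hsym, ← gaussIntegral]
  push_cast
  ring

theorem isFlat_gaussFactor {r : ℝ} (hr : 0 < r) : IsFlat fun u => gaussFactor u (r : ℂ) := by
  refine IsFlat.of_norm_le (κ := r ^ 2 / 2) (M := 1) (by positivity) fun u hu _ => ?_
  rw [norm_gaussFactor_ofReal, one_mul]
  refine le_of_eq ?_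
  congr 1; field_simp

theorem isBigO_id_sqrt : (fun u : ℝ => u) =O[𝓝[>] (0 : ℝ)] fun u : ℝ => √(2 * Real.pi * u) := by
  refine Asymptotics.IsBigO.of_bound 1 ?_
  filter_upwards [eventually_pos_lt_one] with u hu
  rw [one_mul, Real.norm_of_nonneg hu.1.le, Real.norm_of_nonneg (Real.sqrt_nonneg _)]
  refine Real.le_sqrt_of_sq_le ?_
  nlinarith [Real.pi_gt_three, hu.1, hu.2]

/-- **Watson's lemma** for a Gaussian integral. -/
theorem isBigO_gaussIntegral_sub {r ρ : ℝ} (hr : 0 < r) (hρ : r < ρ) (n : ℕ) {f : ℂ → ℂ}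
    (hf : DifferentiableOn ℂ f (Metric.ball 0 ρ)) :
    (fun u : ℝ => gaussIntegral r f u -
      (∑ k ∈ Finset.range n, derivDslope^[k] f 0 * (u : ℂ) ^ k) * (√(2 * Real.pi * u) : ℝ))
      =O[𝓝[>] (0 : ℝ)] fun u : ℝ => √(2 * Real.pi * u) * u ^ n := by
  have h0 : (0 : ℂ) ∈ Metric.ball (0 : ℂ) ρ := Metric.mem_ball_self (hr.trans hρ)
  induction n generalizing f with
  | zero => simpa using isBigO_gaussIntegral hr hρ hf
  | succ n ih =>
    have hflat : IsFlat fun u => f 0 * (gaussIntegral r (fun _ => 1) u - (√(2 * Real.pi * u) : ℝ)) +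
        -(dslope f 0 r - dslope f 0 (-r)) * ((u : ℂ) * gaussFactor u r) :=
      ((isFlat_gaussIntegral_one_sub hr).const_mul _).add
        (((isFlat_gaussFactor hr).mul (g := fun u => (u : ℂ)) 0 (by
          refine Asymptotics.IsBigO.of_bound 1 ?_
          filter_upwards [eventually_pos_lt_one] with u hu
          simp [abs_of_pos hu.1, hu.2.le])).const_mul _)
    -- The error scale carries a factor `√(2πu)`, which dominates `u`; one extra power of `u` in the
    -- flat terms absorbs it.
    have h1 : (fun u : ℝ => u ^ (n + 2)) =O[𝓝[>] (0 : ℝ)]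
        fun u : ℝ => √(2 * Real.pi * u) * u ^ (n + 1) :=
      (isBigO_id_sqrt.mul (Asymptotics.isBigO_refl (fun u : ℝ => u ^ (n + 1)) _)).congr_left
        fun u => by ring
    have h2 : (fun u : ℝ => (u : ℂ) * (gaussIntegral r (derivDslope f) u -
        (∑ k ∈ Finset.range n, derivDslope^[k] (derivDslope f) 0 * (u : ℂ) ^ k) *
          (√(2 * Real.pi * u) : ℝ))) =O[𝓝[>] (0 : ℝ)]
        fun u : ℝ => √(2 * Real.pi * u) * u ^ (n + 1) := by
      have h3 : (fun u : ℝ => (u : ℂ)) =O[𝓝[>] (0 : ℝ)] fun u : ℝ => u :=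
        Asymptotics.IsBigO.of_bound 1 (Eventually.of_forall fun u => by simp)
      exact (h3.mul (ih (hf.derivDslope Metric.isOpen_ball h0))).congr_right fun u => by ring
    refine (((hflat (n + 2)).trans h1).add h2).congr' ?_ EventuallyEq.rfl
    filter_upwards [eventually_pos_lt_one] with u hu
    rw [gaussIntegral_eq hr hρ hu.1 hf, Finset.sum_range_succ']
    simp only [Function.iterate_succ_apply, Function.iterate_zero, id, pow_zero, mul_one, pow_succ]
    have : ∑ k ∈ Finset.range n, derivDslope^[k] (derivDslope f) 0 * ((u : ℂ) ^ k * u) =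
        (∑ k ∈ Finset.range n, derivDslope^[k] (derivDslope f) 0 * (u : ℂ) ^ k) * u := by
      rw [Finset.sum_mul]; exact Finset.sum_congr rfl fun k _ => by ring
    rw [this]; ring

/-- The Gaussian integral of `-δ / t^2 + h` along the upper half circle. -/
theorem integral_upper_half_circle {r ρ u : ℝ} (hr : 0 < r) (hρ : r < ρ) (hu : 0 < u) {h : ℂ → ℂ}
    (hh : DifferentiableOn ℂ h (Metric.ball 0 ρ)) (δ : ℂ) :
    ∫ θ in Real.pi..0, gaussFactor u (circleMap 0 r θ) *
        ((-δ / circleMap 0 r θ ^ 2 + h (circleMap 0 r θ)) * (circleMap 0 r θ * Complex.I)) =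
      2 * δ / r * gaussFactor u r + δ / u * gaussIntegral r (fun _ => 1) u +
        gaussIntegral r h u := by
  have huc : (u : ℂ) ≠ 0 := by exact_mod_cast hu.ne'
  have hrc : (r : ℂ) ≠ 0 := by exact_mod_cast hr.ne'
  have hgd : Differentiable ℂ (gaussFactor u) := fun t =>
    (hasDerivAt_gaussFactor u t).differentiableAt
  have hd : DifferentiableOn ℂ (fun t => gaussFactor u t * (h t + δ / u)) (Metric.ball 0 ρ) :=
    hgd.differentiableOn.mul (hh.add (differentiableOn_const _))
  -- Removing the derivative of `δ e^{-z^2/2u} / z` from the integrand leaves `e^{-z^2/2u} (h +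
  -- δ/u)`, which has no pole. A primitive `H` on the disc then evaluates both the half circle and
  -- the segment `[-r, r]` by the same endpoints; the removed term contributes the boundary value `2
  -- δ / r` times the Gaussian factor.
  obtain ⟨H, hH⟩ := hd.isExactOn_ball
  have hcirc : ∀ θ : ℝ, circleMap 0 r θ ∈ Metric.ball (0 : ℂ) ρ := fun θ => by
    rw [mem_ball_zero_iff, norm_circleMap_zero, abs_of_pos hr]; exact hρ
  have hcne : ∀ θ : ℝ, circleMap 0 r θ ≠ 0 := fun θ => circleMap_ne_center hr.ne'
  have hmem : ∀ t ∈ uIcc (-r) r, (t : ℂ) ∈ Metric.ball (0 : ℂ) ρ := by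
    intro t ht
    rw [uIcc_of_le (by linarith)] at ht
    rw [mem_ball_zero_iff, Complex.norm_real, Real.norm_eq_abs, abs_lt]
    exact ⟨by linarith [ht.1], by linarith [ht.2]⟩
  have e1 : ∀ θ ∈ uIcc Real.pi 0, HasDerivAt (fun θ : ℝ => H (circleMap 0 r θ) +
      δ * (gaussFactor u (circleMap 0 r θ) / circleMap 0 r θ))
      (gaussFactor u (circleMap 0 r θ) *
        ((-δ / circleMap 0 r θ ^ 2 + h (circleMap 0 r θ)) * (circleMap 0 r θ * Complex.I))) θ := by
    intro θ _
    have a1 := hH _ (hcirc θ)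
    have a2 : HasDerivAt (fun z : ℂ => H z + δ * (gaussFactor u z / z)) _ (circleMap 0 r θ) :=
      a1.add (((hasDerivAt_gaussFactor u _).div (hasDerivAt_id' (circleMap 0 r θ))
        (hcne θ)).const_mul δ)
    refine (HasDerivAt.scomp θ a2 (hasDerivAt_circleMap 0 r θ)).congr_deriv ?_
    have := hcne θ
    rw [smul_eq_mul]
    field_simp
    ring
  have hcc : Continuous fun θ : ℝ => circleMap 0 r θ := continuous_circleMap 0 r
  have i1 : IntervalIntegrable (fun θ : ℝ => gaussFactor u (circleMap 0 r θ) *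
        ((-δ / circleMap 0 r θ ^ 2 + h (circleMap 0 r θ)) * (circleMap 0 r θ * Complex.I)))
      MeasureTheory.volume Real.pi 0 := by
    refine Continuous.intervalIntegrable ?_ _ _
    refine (hgd.continuous.comp hcc).mul (((continuous_const.div (hcc.pow 2)
      fun θ => pow_ne_zero 2 (hcne θ)).add ?_).mul (hcc.mul continuous_const))
    exact hh.continuousOn.comp_continuous hcc hcirc
  rw [intervalIntegral.integral_eq_sub_of_hasDerivAt e1 i1]
  have e2 : ∀ t ∈ uIcc (-r) r, HasDerivAt (fun t : ℝ => H t)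
      (gaussFactor u (t : ℂ) * (h t + δ / u)) t := fun t ht => (hH _ (hmem t ht)).comp_ofReal
  have hcg : Continuous fun t : ℝ => gaussFactor u (t : ℂ) :=
    hgd.continuous.comp Complex.continuous_ofReal
  have i2 : IntervalIntegrable (fun t : ℝ => gaussFactor u (t : ℂ) * h t)
      MeasureTheory.volume (-r) r :=
    (hcg.continuousOn.mul (hh.continuousOn.comp Complex.continuous_ofReal.continuousOn
      hmem)).intervalIntegrable
  have i3 : IntervalIntegrable (fun t : ℝ => δ / u * (gaussFactor u (t : ℂ) * 1))
      MeasureTheory.volume (-r) r :=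
    (continuous_const.mul (hcg.mul continuous_const)).intervalIntegrable _ _
  have e3 : δ / u * gaussIntegral r (fun _ => 1) u + gaussIntegral r h u = H r - H (-r) := by
    have := intervalIntegral.integral_eq_sub_of_hasDerivAt e2 ((i3.add i2).congr fun t _ => by
      ring)
    rw [gaussIntegral, gaussIntegral, ← intervalIntegral.integral_const_mul,
      ← intervalIntegral.integral_add i3 i2]
    push_cast at this
    rw [← this]
    exact intervalIntegral.integral_congr fun t _ => by ring
  have c0 : circleMap 0 r 0 = r := by simp [circleMap]
  have cpi : circleMap 0 r Real.pi = -r := by simp [circleMap]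
  have hsym : gaussFactor u (-(r : ℂ)) = gaussFactor u r := by simp [gaussFactor]
  rw [add_assoc, e3, c0, cpi, hsym]
  field_simp
  ring

/-- The asymptotic expansion of a Gaussian integral with a double pole at the origin. -/
theorem isBigO_gaussian_expansion {r ρ : ℝ} (hr : 0 < r) (hρ : r < ρ) {h : ℂ → ℂ}
    (hh : DifferentiableOn ℂ h (Metric.ball 0 ρ)) (δ : ℂ) {E I : ℝ → ℂ} (hE : IsFlat E)
    (hI : ∀ u : ℝ, 0 < u → I u = E u + δ / u * gaussIntegral r (fun _ => 1) u +
      gaussIntegral r h u) (c : ℕ → ℂ) (hc0 : c 0 = δ)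
    (hc : ∀ k, c (k + 1) = (-1) ^ (k + 1) * derivDslope^[k] h 0) (n : ℕ) :
    (fun u : ℝ => ((u / √(2 * Real.pi * u) : ℝ) : ℂ) * I u -
      ∑ k ∈ Finset.range n, c k * (-(u : ℂ)) ^ k) =O[𝓝[>] (0 : ℝ)] fun u : ℝ => u ^ n := by
  -- The double pole accounts for `c 0`, so `n` terms of Watson's lemma for `h` yield `n + 1`
  -- coefficients. Dropping the last one costs a term of size `u ^ n`, and this also covers the
  -- empty sum.
  suffices hs : ∀ n : ℕ, (fun u : ℝ => ((u / √(2 * Real.pi * u) : ℝ) : ℂ) * I u -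
      ∑ k ∈ Finset.range (n + 1), c k * (-(u : ℂ)) ^ k)
        =O[𝓝[>] (0 : ℝ)] fun u : ℝ => u ^ (n + 1) by
    have h1 : (fun u : ℝ => c n * (-(u : ℂ)) ^ n) =O[𝓝[>] (0 : ℝ)] fun u : ℝ => u ^ n :=
      Asymptotics.IsBigO.of_bound ‖c n‖ (Eventually.of_forall fun u => by simp)
    refine (((hs n).trans (isBigO_pow_of_le n.le_succ)).add h1).congr_left fun u => ?_
    rw [Finset.sum_range_succ]; ring
  clear n
  intro n
  have hpref : (fun u : ℝ => (u : ℂ) ^ 0 * ((u / √(2 * Real.pi * u) : ℝ) : ℂ))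
      =O[𝓝[>] (0 : ℝ)] fun _ => (1 : ℝ) := by
    obtain ⟨b, hb⟩ := isBigO_id_sqrt.bound
    refine Asymptotics.IsBigO.of_bound b ?_
    filter_upwards [hb, eventually_pos_lt_one] with u h1 h2
    have : 0 < √(2 * Real.pi * u) := Real.sqrt_pos.2 (by have := h2.1; positivity)
    rw [pow_zero, one_mul, Complex.norm_real, norm_div, norm_one, mul_one,
      div_le_iff₀ (norm_pos_iff.2 this.ne')]
    exact h1
  have f1 : IsFlat fun u => ((u / √(2 * Real.pi * u) : ℝ) : ℂ) * E u := hE.mul 0 hpref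
  have f2 : IsFlat fun u => ((u / √(2 * Real.pi * u) : ℝ) : ℂ) *
      (δ * ((u : ℂ)⁻¹ * (gaussIntegral r (fun _ => 1) u - (√(2 * Real.pi * u) : ℝ)))) := by
    refine ((IsFlat.mul (isFlat_gaussIntegral_one_sub hr) 1 ?_).const_mul δ).mul 0 hpref
    refine Asymptotics.IsBigO.of_bound 1 ?_
    filter_upwards [eventually_pos_lt_one] with u hu
    have : (u : ℂ) ≠ 0 := by exact_mod_cast hu.1.ne'
    simp [this]
  have f3 : (fun u : ℝ => ((u / √(2 * Real.pi * u) : ℝ) : ℂ) * (gaussIntegral r h u -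
      (∑ k ∈ Finset.range n, derivDslope^[k] h 0 * (u : ℂ) ^ k) * (√(2 * Real.pi * u) : ℝ)))
      =O[𝓝[>] (0 : ℝ)] fun u : ℝ => u ^ (n + 1) := by
    obtain ⟨b, hb⟩ := (isBigO_gaussIntegral_sub hr hρ n hh).bound
    refine Asymptotics.IsBigO.of_bound b ?_
    filter_upwards [hb, eventually_pos_lt_one] with u h1 h2
    have h3 : 0 < √(2 * Real.pi * u) := Real.sqrt_pos.2 (by have := h2.1; positivity)
    have h4 := h2.1
    rw [norm_mul, Complex.norm_real, Real.norm_of_nonneg (by positivity : 0 ≤ u / _)]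
    rw [Real.norm_of_nonneg (by positivity)] at h1 ⊢
    calc u / √(2 * Real.pi * u) * ‖_‖ ≤ u / √(2 * Real.pi * u) *
          (b * (√(2 * Real.pi * u) * u ^ n)) := by gcongr
      _ = _ := by rw [pow_succ]; field_simp
  refine (((f1 (n + 1)).add (f2 (n + 1))).add f3).congr' ?_ EventuallyEq.rfl
  filter_upwards [eventually_pos_lt_one] with u hu
  have h3 : ((√(2 * Real.pi * u) : ℝ) : ℂ) ≠ 0 := by
    have : 0 < √(2 * Real.pi * u) := Real.sqrt_pos.2 (by have := hu.1; positivity)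
    exact_mod_cast this.ne'
  have h4 : (u : ℂ) ≠ 0 := by exact_mod_cast hu.1.ne'
  rw [hI u hu.1, Finset.sum_range_succ', hc0]
  have h5 : ∑ k ∈ Finset.range n, c (k + 1) * (-(u : ℂ)) ^ (k + 1) =
      u * ∑ k ∈ Finset.range n, derivDslope^[k] h 0 * (u : ℂ) ^ k := by
    rw [Finset.mul_sum]
    refine Finset.sum_congr rfl fun k _ => ?_
    rw [hc, neg_pow (u : ℂ), pow_succ (u : ℂ)]
    have : ((-1 : ℂ)) ^ (k + 1) * (-1) ^ (k + 1) = 1 := by rw [← mul_pow]; simp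
    linear_combination (derivDslope^[k] h 0 * (u ^ k * u)) * this
  rw [h5]
  push_cast
  field_simp
  ring

end Laplace

/-! ### Change of charts for one-forms, and Liouville's theorem. -/

section ChartCalculus

variable {S : Type*} [TopologicalSpace S] [ChartedSpace ℂ S]

theorem chartAt_mem_complexAtlas [IsManifold 𝓘(ℂ) ω S] (p : S) :
    chartAt ℂ p ∈ IsManifold.maximalAtlas 𝓘(ℂ) ω S :=
  IsManifold.chart_mem_maximalAtlas p

theorem analyticAt_transition [IsManifold 𝓘(ℂ) ω S] {φ ψ : OpenPartialHomeomorph S ℂ}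
    (hφ : φ ∈ IsManifold.maximalAtlas 𝓘(ℂ) ω S) (hψ : ψ ∈ IsManifold.maximalAtlas 𝓘(ℂ) ω S)
    {w : ℂ} (hw : w ∈ φ.target) (hw' : φ.symm w ∈ ψ.source) :
    AnalyticAt ℂ (ψ ∘ φ.symm) w := by
  have h1 : ContMDiffAt 𝓘(ℂ) 𝓘(ℂ) ω φ.symm w := contMDiffAt_symm_of_mem_maximalAtlas hφ hw
  have h2 : ContMDiffAt 𝓘(ℂ) 𝓘(ℂ) ω ψ (φ.symm w) := contMDiffAt_of_mem_maximalAtlas hψ hw'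
  exact (contMDiffAt_iff_contDiffAt.1 (h2.comp w h1)).analyticAt

theorem eventually_symm_mem_source {S : Type*} [TopologicalSpace S] {φ ψ :
    OpenPartialHomeomorph S ℂ}
    {w : ℂ} (hw : w ∈ φ.target) (hw' : φ.symm w ∈ ψ.source) :
    ∀ᶠ v in 𝓝 w, φ.symm v ∈ ψ.source :=
  (φ.continuousAt_symm hw).eventually (ψ.open_source.mem_nhds hw')

/-- Composing with a transition map changes the chart in which a function is expressed. -/
theorem eventuallyEq_comp_transition {S : Type*} [TopologicalSpace S] {X : Type*} (f : S → X)
    {φ ψ : OpenPartialHomeomorph S ℂ}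
    {w : ℂ} (hw : w ∈ φ.target) (hw' : φ.symm w ∈ ψ.source) :
    f ∘ φ.symm =ᶠ[𝓝 w] (f ∘ ψ.symm) ∘ (ψ ∘ φ.symm) := by
  filter_upwards [eventually_symm_mem_source hw hw'] with v hv
  simp [ψ.left_inv hv]

theorem deriv_transition_mul_deriv_transition [IsManifold 𝓘(ℂ) ω S]
    {φ ψ : OpenPartialHomeomorph S ℂ}
    (hφ : φ ∈ IsManifold.maximalAtlas 𝓘(ℂ) ω S) (hψ : ψ ∈ IsManifold.maximalAtlas 𝓘(ℂ) ω S)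
    {p : S} (hp : p ∈ φ.source) (hp' : p ∈ ψ.source) :
    deriv (φ ∘ ψ.symm) (ψ p) * deriv (ψ ∘ φ.symm) (φ p) = 1 := by
  have h1 : AnalyticAt ℂ (ψ ∘ φ.symm) (φ p) :=
    analyticAt_transition hφ hψ (φ.map_source hp) (by rwa [φ.left_inv hp])
  have h2 : AnalyticAt ℂ (φ ∘ ψ.symm) (ψ p) :=
    analyticAt_transition hψ hφ (ψ.map_source hp') (by rwa [ψ.left_inv hp'])
  have e : (ψ ∘ φ.symm) (φ p) = ψ p := by simp [φ.left_inv hp]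
  have h3 : HasDerivAt ((φ ∘ ψ.symm) ∘ (ψ ∘ φ.symm))
      (deriv (φ ∘ ψ.symm) (ψ p) * deriv (ψ ∘ φ.symm) (φ p)) (φ p) := by
    refine HasDerivAt.comp _ ?_ h1.differentiableAt.hasDerivAt
    rw [e]; exact h2.differentiableAt.hasDerivAt
  have h4 : φ ∘ φ.symm =ᶠ[𝓝 (φ p)] (φ ∘ ψ.symm) ∘ (ψ ∘ φ.symm) :=
    eventuallyEq_comp_transition φ (φ.map_source hp) (by rwa [φ.left_inv hp])
  have h5 : φ ∘ φ.symm =ᶠ[𝓝 (φ p)] id := by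
    filter_upwards [φ.open_target.mem_nhds (φ.map_source hp)] with v hv
    simp [φ.right_inv hv]
  rw [← h3.deriv, ← h4.deriv_eq, h5.deriv_eq, deriv_id]

theorem velocity_symm {φ : OpenPartialHomeomorph S ℂ} {p : S} (hp : p ∈ φ.source) :
    velocity φ.symm (φ p) = deriv (chartAt ℂ p ∘ φ.symm) (φ p) := by
  simp only [velocity, φ.left_inv hp]; rfl

theorem velocity_symm_ne_zero [IsManifold 𝓘(ℂ) ω S] {φ : OpenPartialHomeomorph S ℂ}
    (hφ : φ ∈ IsManifold.maximalAtlas 𝓘(ℂ) ω S) {p : S} (hp : p ∈ φ.source) :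
    velocity φ.symm (φ p) ≠ 0 := by
  rw [velocity_symm hp]
  exact right_ne_zero_of_mul_eq_one (deriv_transition_mul_deriv_transition hφ
    (chartAt_mem_complexAtlas p) hp (mem_chart_source ℂ p))

theorem velocity_chartAt_symm (p : S) :
    velocity (chartAt ℂ p).symm (chartAt ℂ p p) = 1 := by
  rw [velocity_symm (mem_chart_source ℂ p)]
  have h5 : chartAt ℂ p ∘ (chartAt ℂ p).symm =ᶠ[𝓝 (chartAt ℂ p p)] id := by
    filter_upwards [(chartAt ℂ p).open_target.mem_nhds (mem_chart_target ℂ p)] with v hv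
    simp [(chartAt ℂ p).right_inv hv]
  rw [h5.deriv_eq, deriv_id]

/-- The chain rule for the velocity of a curve, in terms of an arbitrary chart. -/
theorem velocity_eq_mul_deriv [IsManifold 𝓘(ℂ) ω S] {𝕜 : Type*} [NontriviallyNormedField 𝕜]
    [NormedAlgebra 𝕜 ℂ] {φ : OpenPartialHomeomorph S ℂ}
    (hφ : φ ∈ IsManifold.maximalAtlas 𝓘(ℂ) ω S) {c : 𝕜 → S} {t : 𝕜}
    (hc : ContinuousAt c t) (ht : c t ∈ φ.source) (hd : DifferentiableAt 𝕜 (φ ∘ c) t) :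
    velocity c t = velocity φ.symm (φ (c t)) * deriv (φ ∘ c) t := by
  have h1 : AnalyticAt ℂ (chartAt ℂ (c t) ∘ φ.symm) (φ (c t)) :=
    analyticAt_transition hφ (chartAt_mem_complexAtlas _) (φ.map_source ht)
      (by rw [φ.left_inv ht]; exact mem_chart_source ℂ _)
  have h2 : HasDerivAt ((chartAt ℂ (c t) ∘ φ.symm) ∘ (φ ∘ c))
      (deriv (φ ∘ c) t • deriv (chartAt ℂ (c t) ∘ φ.symm) (φ (c t))) t :=
    HasDerivAt.scomp t h1.differentiableAt.hasDerivAt hd.hasDerivAt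
  have h3 : (fun s => chartAt ℂ (c t) (c s)) =ᶠ[𝓝 t]
      (chartAt ℂ (c t) ∘ φ.symm) ∘ (φ ∘ c) := by
    filter_upwards [hc.eventually (φ.open_source.mem_nhds ht)] with s hs
    simp [φ.left_inv hs]
  rw [velocity, h3.deriv_eq, h2.deriv, velocity_symm ht, smul_eq_mul, mul_comm]

theorem OneForm.pullback_eq_mul_deriv [IsManifold 𝓘(ℂ) ω S] {𝕜 : Type*}
    [NontriviallyNormedField 𝕜] [NormedAlgebra 𝕜 ℂ] (α : OneForm S)
    {φ : OpenPartialHomeomorph S ℂ} (hφ : φ ∈ IsManifold.maximalAtlas 𝓘(ℂ) ω S) {c : 𝕜 → S} {t : 𝕜}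
    (hc : ContinuousAt c t) (ht : c t ∈ φ.source) (hd : DifferentiableAt 𝕜 (φ ∘ c) t) :
    α.pullback c t = α.pullback φ.symm (φ (c t)) * deriv (φ ∘ c) t := by
  rw [OneForm.pullback, OneForm.pullback, velocity_eq_mul_deriv hφ hc ht hd, φ.left_inv ht,
    mul_assoc]

theorem OneForm.pullback_symm_eq [IsManifold 𝓘(ℂ) ω S] (α : OneForm S)
    {φ ψ : OpenPartialHomeomorph S ℂ} (hφ : φ ∈ IsManifold.maximalAtlas 𝓘(ℂ) ω S)
    (hψ : ψ ∈ IsManifold.maximalAtlas 𝓘(ℂ) ω S) {w : ℂ} (hw : w ∈ φ.target)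
    (hw' : φ.symm w ∈ ψ.source) :
    α.pullback φ.symm w = α.pullback ψ.symm (ψ (φ.symm w)) * deriv (ψ ∘ φ.symm) w :=
  α.pullback_eq_mul_deriv hψ (φ.continuousAt_symm hw) hw'
    (analyticAt_transition hφ hψ hw hw').differentiableAt

theorem OneForm.analyticAt_pullback_symm [IsManifold 𝓘(ℂ) ω S] {α : OneForm S}
    {φ ψ : OpenPartialHomeomorph S ℂ} (hφ : φ ∈ IsManifold.maximalAtlas 𝓘(ℂ) ω S)
    (hψ : ψ ∈ IsManifold.maximalAtlas 𝓘(ℂ) ω S) {w : ℂ} (hw : w ∈ φ.target)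
    (hw' : φ.symm w ∈ ψ.source) (h : AnalyticAt ℂ (α.pullback ψ.symm) (ψ (φ.symm w))) :
    AnalyticAt ℂ (α.pullback φ.symm) w := by
  have ht := analyticAt_transition hφ hψ hw hw'
  refine ((h.comp_of_eq ht rfl).mul ht.deriv).congr ?_
  filter_upwards [eventually_symm_mem_source hw hw', φ.open_target.mem_nhds hw] with v hv hv'
  exact (α.pullback_symm_eq hφ hψ hv' hv).symm

theorem pullback_differential [IsManifold 𝓘(ℂ) ω S] {f : S → ℂ}
    {φ : OpenPartialHomeomorph S ℂ} (hφ : φ ∈ IsManifold.maximalAtlas 𝓘(ℂ) ω S)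
    {w : ℂ} (hw : w ∈ φ.target) (h : DifferentiableAt ℂ (f ∘ φ.symm) w) :
    (differential f).pullback φ.symm w = deriv (f ∘ φ.symm) w := by
  obtain ⟨p, hp, rfl⟩ : ∃ p ∈ φ.source, φ p = w := ⟨φ.symm w, φ.map_target hw, φ.right_inv hw⟩
  have hc := mem_chart_source ℂ p
  have e := eventuallyEq_comp_transition f (mem_chart_target ℂ p) (ψ := φ)
    (by rwa [(chartAt ℂ p).left_inv hc])
  have ha := analyticAt_transition (chartAt_mem_complexAtlas p) hφ (mem_chart_target ℂ p)
    (by rwa [(chartAt ℂ p).left_inv hc])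
  have e2 : (φ ∘ (chartAt ℂ p).symm) (chartAt ℂ p p) = φ p := by simp [(chartAt ℂ p).left_inv hc]
  have hd : HasDerivAt ((f ∘ φ.symm) ∘ (φ ∘ (chartAt ℂ p).symm))
      (deriv (f ∘ φ.symm) (φ p) * deriv (φ ∘ (chartAt ℂ p).symm) (chartAt ℂ p p))
      (chartAt ℂ p p) := by
    refine HasDerivAt.comp _ ?_ ha.differentiableAt.hasDerivAt
    rw [e2]; exact h.hasDerivAt
  rw [OneForm.pullback, φ.left_inv hp, velocity_symm hp, differential, e.deriv_eq, hd.deriv,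
    mul_assoc, deriv_transition_mul_deriv_transition hφ (chartAt_mem_complexAtlas p) hp hc, mul_one]

/-- The quotient of two one-forms is a function that can be computed in any chart. -/
theorem OneForm.div_eq_pullback_div [IsManifold 𝓘(ℂ) ω S] (α α' : OneForm S)
    {φ : OpenPartialHomeomorph S ℂ} (hφ : φ ∈ IsManifold.maximalAtlas 𝓘(ℂ) ω S)
    {w : ℂ} (hw : w ∈ φ.target) :
    α (φ.symm w) / α' (φ.symm w) = α.pullback φ.symm w / α'.pullback φ.symm w := by
  have h := velocity_symm_ne_zero hφ (φ.map_target hw)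
  rw [φ.right_inv hw] at h
  rw [OneForm.pullback, OneForm.pullback, mul_div_mul_right _ _ h]

/-- **Liouville's theorem** on a compact connected Riemann surface: a function whose isolated
singularities are all removable is constant off its singularities. -/
theorem exists_eventuallyEq_const_of_removable [IsManifold 𝓘(ℂ) ω S] [CompactSpace S]
    [T2Space S] [PreconnectedSpace S] (F : S → ℂ)
    (hF : ∀ p, ∃ φ ∈ IsManifold.maximalAtlas 𝓘(ℂ) ω S, ∃ _ : p ∈ φ.source, ∃ h : ℂ → ℂ,
      AnalyticAt ℂ h (φ p) ∧ F ∘ φ.symm =ᶠ[𝓝[≠] (φ p)] h) :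
    ∃ c : ℂ, ∀ (p : S) (φ : OpenPartialHomeomorph S ℂ), p ∈ φ.source →
      F ∘ φ.symm =ᶠ[𝓝[≠] (φ p)] fun _ => c := by
  choose φ hφ hp h ha he using hF
  -- The values of `F` at its singular points are arbitrary; `G` replaces each of them by the value
  -- of the local holomorphic extension.
  let G : S → ℂ := fun p => h p (φ p p)
  -- punctured neighbourhoods correspond under charts
  have tend : ∀ (p : S) (ψ : OpenPartialHomeomorph S ℂ), p ∈ ψ.source →
      Tendsto ψ (𝓝[≠] p) (𝓝[≠] (ψ p)) := by
    intro p ψ hpψ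
    refine tendsto_nhdsWithin_iff.2 ⟨(ψ.continuousAt hpψ).tendsto.mono_left nhdsWithin_le_nhds, ?_⟩
    filter_upwards [self_mem_nhdsWithin,
      mem_nhdsWithin_of_mem_nhds (ψ.open_source.mem_nhds hpψ)] with q hq hq' e
    exact hq (ψ.injOn hq' hpψ e)
  have tend' : ∀ (p : S) (ψ : OpenPartialHomeomorph S ℂ), p ∈ ψ.source →
      Tendsto ψ.symm (𝓝[≠] (ψ p)) (𝓝[≠] p) := by
    intro p ψ hpψ
    refine tendsto_nhdsWithin_iff.2 ⟨?_, ?_⟩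
    · have := (ψ.continuousAt_symm (ψ.map_source hpψ)).tendsto
      rw [ψ.left_inv hpψ] at this
      exact this.mono_left nhdsWithin_le_nhds
    · filter_upwards [self_mem_nhdsWithin,
        mem_nhdsWithin_of_mem_nhds (ψ.open_target.mem_nhds (ψ.map_source hpψ))] with q hq hq' e
      refine hq ?_
      rw [mem_singleton_iff, ← ψ.right_inv hq', e]
  -- `F` agrees with `h ∘ φ` on a punctured neighbourhood
  have key : ∀ p, F =ᶠ[𝓝[≠] p] h p ∘ φ p := by
    intro p
    have := (tend p (φ p) (hp p)).eventually (he p)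
    filter_upwards [this, mem_nhdsWithin_of_mem_nhds ((φ p).open_source.mem_nhds (hp p))]
      with q hq hq'
    simpa [(φ p).left_inv hq'] using hq
  have keyG : ∀ p, G =ᶠ[𝓝 p] h p ∘ φ p := by
    intro p
    -- `G q` is defined with the chart and extension chosen at `q`, and is compared with those
    -- chosen at `p`: both are the limit of `F` at `q`, unique because `q` is not isolated.
    have h1 : ∀ᶠ q in 𝓝[≠] p, G q = h p (φ p q) := by
      have h2 := (eventually_eventually_nhds.2
        (eventually_nhdsWithin_iff.1 (key p))).filter_mono (nhdsWithin_le_nhds (s := {p}ᶜ))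
      have h3 : ∀ᶠ q in 𝓝 p, AnalyticAt ℂ (h p) (φ p q) :=
        ((φ p).continuousAt (hp p)).eventually (ha p).eventually_analyticAt
      filter_upwards [h2, self_mem_nhdsWithin, mem_nhdsWithin_of_mem_nhds h3,
        mem_nhdsWithin_of_mem_nhds ((φ p).open_source.mem_nhds (hp p))] with q hq hqp hq3 hqs
      have hq' : F =ᶠ[𝓝 q] h p ∘ φ p := by
        filter_upwards [hq, isOpen_ne.mem_nhds hqp] with s hs hs' using hs hs'
      have hneB : (𝓝[≠] q).NeBot := by
        have : (𝓝[≠] (φ q q)).NeBot := inferInstance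
        exact this.map (φ q).symm |>.mono (tend' q (φ q) (hp q))
      have l1 : Tendsto F (𝓝[≠] q) (𝓝 (h p (φ p q))) := by
        have : Tendsto (h p ∘ φ p) (𝓝 q) (𝓝 (h p (φ p q))) :=
          ContinuousAt.comp (f := φ p) (g := h p) hq3.continuousAt ((φ p).continuousAt hqs)
        exact (this.congr' hq'.symm).mono_left nhdsWithin_le_nhds
      have l2 : Tendsto F (𝓝[≠] q) (𝓝 (G q)) := by
        have : Tendsto (h q ∘ φ q) (𝓝 q) (𝓝 (h q (φ q q))) :=
          ContinuousAt.comp (f := φ q) (g := h q) (ha q).continuousAt ((φ q).continuousAt (hp q))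
        exact (this.mono_left nhdsWithin_le_nhds).congr' (key q).symm
      exact tendsto_nhds_unique l2 l1
    filter_upwards [eventually_nhdsWithin_iff.1 h1] with q hq
    by_cases hqp : q = p
    · subst hqp; rfl
    · exact hq hqp
  have hG : MDifferentiable 𝓘(ℂ) 𝓘(ℂ) G := by
    intro p
    have h1 : MDifferentiableAt 𝓘(ℂ) 𝓘(ℂ) (h p) (φ p p) :=
      (ha p).differentiableAt.mdifferentiableAt
    have h2 : MDifferentiableAt 𝓘(ℂ) 𝓘(ℂ) (φ p) p :=
      (contMDiffAt_of_mem_maximalAtlas (hφ p) (hp p)).mdifferentiableAt (by simp)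
    exact (h1.comp p h2).congr_of_eventuallyEq (keyG p)
  obtain ⟨c, hc⟩ := hG.exists_eq_const_of_compactSpace
  refine ⟨c, fun p ψ hpψ => ?_⟩
  have h1 : ∀ᶠ q in 𝓝[≠] p, F q = c := by
    filter_upwards [key p, mem_nhdsWithin_of_mem_nhds (keyG p)] with q h1 h2
    rw [h1, ← h2, hc]; rfl
  exact (tend' p ψ hpψ).eventually h1

end ChartCalculus

/-! ### The residue at a simple pole. -/

section Residue

theorem residue_div_self {g : ℂ → ℂ} (hg : AnalyticAt ℂ g 0) :
    residue (fun t => g t / t) 0 = g 0 := by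
  obtain ⟨ε, hε, hd⟩ := Metric.eventually_nhds_iff_ball.1 hg.eventually_analyticAt
  refine Tendsto.limUnder_eq (tendsto_const_nhds.congr' ?_)
  filter_upwards [Ioo_mem_nhdsGT hε] with r hr
  have h1 : DiffContOnCl ℂ g (Metric.ball 0 r) := by
    refine DifferentiableOn.diffContOnCl fun z hz => ?_
    rw [closure_ball _ hr.1.ne'] at hz
    exact (hd z (Metric.closedBall_subset_ball hr.2 hz)).differentiableAt.differentiableWithinAt
  have h2 := h1.two_pi_i_inv_smul_circleIntegral_sub_inv_smul (Metric.mem_ball_self hr.1)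
  rw [← h2, smul_eq_mul]
  congr 2
  ext z
  rw [sub_zero, smul_eq_mul, div_eq_inv_mul]

end Residue

/-! ### The function `x` in charts, its critical points and the Airy coordinates. -/

namespace SpectralCurve

variable {S : Type*} [TopologicalSpace S] [ChartedSpace ℂ S] {N : ℕ}
  {C : SpectralCurve S N}

theorem isOpen_compl_bdry [T2Space S] (C : SpectralCurve S N) : IsOpen C.bdryᶜ :=
  C.finite_bdry.isClosed.isOpen_compl

theorem crit_notMem_bdry (C : SpectralCurve S N) (β : Fin N) : C.crit β ∉ C.bdry :=
  ((C.mem_range_crit_iff _).1 (mem_range_self β)).1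

theorem analyticAt_x {φ : OpenPartialHomeomorph S ℂ}
    (hφ : φ ∈ IsManifold.maximalAtlas 𝓘(ℂ) ω S) {w : ℂ} (hw : w ∈ φ.target)
    (hp : φ.symm w ∉ C.bdry) : AnalyticAt ℂ (C.x ∘ φ.symm) w :=
  (contMDiffAt_iff_contDiffAt.1 ((C.holomorphic_x _ hp).comp w
    (contMDiffAt_symm_of_mem_maximalAtlas hφ hw))).analyticAt

theorem airy_zero_mem_target (A : AiryCoordinates C) (γ : Fin N) : (0 : ℂ) ∈
    (A.chart γ).target := by
  rw [← A.chart_crit γ]; exact (A.chart γ).map_source (A.mem_source γ)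

theorem airy_symm_zero (A : AiryCoordinates C) (γ : Fin N) : (A.chart γ).symm 0 = C.crit γ := by
  rw [← A.chart_crit γ, (A.chart γ).left_inv (A.mem_source γ)]

theorem x_airy_symm (A : AiryCoordinates C) {γ : Fin N} {t : ℂ} (ht : t ∈ (A.chart γ).target) :
    C.x ((A.chart γ).symm t) = C.x (C.crit γ) + t ^ 2 / 2 := by
  rw [A.x_eq γ _ ((A.chart γ).map_target ht), (A.chart γ).right_inv ht]

theorem x_comp_airy_symm_eventuallyEq (A : AiryCoordinates C) {γ : Fin N} {t : ℂ} (ht : t ∈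
    (A.chart γ).target) :
    C.x ∘ (A.chart γ).symm =ᶠ[𝓝 t] fun t => C.x (C.crit γ) + t ^ 2 / 2 := by
  filter_upwards [(A.chart γ).open_target.mem_nhds ht] with s hs using x_airy_symm A hs

theorem deriv_x_comp_airy_symm (A : AiryCoordinates C) {γ : Fin N} {t : ℂ} (ht : t ∈
    (A.chart γ).target) :
    deriv (C.x ∘ (A.chart γ).symm) t = t := by
  rw [(x_comp_airy_symm_eventuallyEq A ht).deriv_eq]
  have : HasDerivAt (fun t : ℂ => C.x (C.crit γ) + t ^ 2 / 2) (2 * t / 2) t := by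
    simpa using ((hasDerivAt_pow 2 t).div_const 2).const_add (C.x (C.crit γ))
  rw [this.deriv]; ring

theorem eventually_notMem_special [T2Space S] (C : SpectralCurve S N) {b : S} {φ :
    OpenPartialHomeomorph S ℂ} (hb : b ∈ φ.source) :
    ∀ᶠ w in 𝓝[≠] (φ b), w ∈ φ.target ∧ φ.symm w ∉ C.bdry ∧ φ.symm w ∉ range C.crit := by
  have hfin : (C.bdry ∪ range C.crit).Finite := C.finite_bdry.union (finite_range _)
  have h1 : ((C.bdry ∪ range C.crit) \ {b})ᶜ ∈ 𝓝 b :=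
    (hfin.subset sdiff_subset).isClosed.isOpen_compl.mem_nhds (by simp)
  have h2 : Tendsto φ.symm (𝓝 (φ b)) (𝓝 b) := by
    have := φ.continuousAt_symm (φ.map_source hb)
    rwa [ContinuousAt, φ.left_inv hb] at this
  rw [eventually_nhdsWithin_iff]
  filter_upwards [h2.eventually h1, φ.open_target.mem_nhds (φ.map_source hb)] with w hw hwt hne
  have h3 : φ.symm w ≠ b := fun h => hne (by rw [mem_singleton_iff, ← h, φ.right_inv hwt])
  refine ⟨hwt, fun h => hw ⟨Or.inl h, h3⟩, fun h => hw ⟨Or.inr h, h3⟩⟩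

theorem IsRMatrix.unique {A : AiryCoordinates C} {B : BiDifferential S}
    {L : ∀ γ, LefschetzThimble A γ} {R R' : ℕ → Matrix (Fin N) (Fin N) ℂ}
    (hR : IsRMatrix B L R) (hR' : IsRMatrix B L R') : R = R' := by
  ext k β γ
  refine sub_eq_zero.1
    (eq_zero_of_isBigO_sum (k + 1) (fun j => R j β γ - R' j β γ) ?_ k k.lt_succ_self)
  refine ((hR' β γ (k + 1)).sub (hR β γ (k + 1))).congr_left fun u => ?_
  simp only [sub_mul, Finset.sum_sub_distrib]
  ring

variable [IsManifold 𝓘(ℂ) ω S]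

section Function

theorem pullback_differential_x {φ : OpenPartialHomeomorph S ℂ}
    (hφ : φ ∈ IsManifold.maximalAtlas 𝓘(ℂ) ω S) {w : ℂ} (hw : w ∈ φ.target)
    (hp : φ.symm w ∉ C.bdry) :
    (differential C.x).pullback φ.symm w = deriv (C.x ∘ φ.symm) w :=
  pullback_differential hφ hw (analyticAt_x hφ hw hp).differentiableAt

theorem deriv_x_ne_zero {φ : OpenPartialHomeomorph S ℂ}
    (hφ : φ ∈ IsManifold.maximalAtlas 𝓘(ℂ) ω S) {w : ℂ} (hw : w ∈ φ.target)
    (hp : φ.symm w ∉ C.bdry) (hp' : φ.symm w ∉ range C.crit) :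
    deriv (C.x ∘ φ.symm) w ≠ 0 := by
  rw [← pullback_differential_x hφ hw hp, OneForm.pullback]
  have h := velocity_symm_ne_zero hφ (φ.map_target hw)
  rw [φ.right_inv hw] at h
  exact mul_ne_zero (fun h0 => hp' ((C.mem_range_crit_iff _).2 ⟨hp, h0⟩)) h

theorem exists_crit_eq_of_deriv_x_eq_zero {φ : OpenPartialHomeomorph S ℂ}
    (hφ : φ ∈ IsManifold.maximalAtlas 𝓘(ℂ) ω S) {w : ℂ} (hw : w ∈ φ.target)
    {β : Fin N} (hp : φ.symm w = C.crit β) : deriv (C.x ∘ φ.symm) w = 0 := by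
  rw [← pullback_differential_x hφ hw (hp ▸ C.crit_notMem_bdry β), OneForm.pullback, hp,
    ((C.mem_range_crit_iff _).1 (mem_range_self β)).2, zero_mul]

end Function

section Airy

variable (A : AiryCoordinates C)

/-- In the Airy coordinate `dx = t dt`, which vanishes only at the centre; so an Airy chart meets no
other critical point. -/
theorem airy_symm_ne_crit {γ β : Fin N} {t : ℂ} (ht : t ∈ (A.chart γ).target) (ht0 : t ≠ 0) :
    (A.chart γ).symm t ≠ C.crit β := fun h =>
  ht0 (by rw [← deriv_x_comp_airy_symm A ht,
    exists_crit_eq_of_deriv_x_eq_zero (A.mem_maximalAtlas γ) ht h])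

end Airy

/-! ### The forms `dζ^β` and their poles. -/

section Zeta

variable (A : AiryCoordinates C) {B : BiDifferential S}

/-- As `1 / η^β` has a simple pole, Cauchy's formula turns the residue into evaluation of the
Bergman kernel at `z^β`. The velocity factor passes from the preferred coordinate there to the Airy
coordinate. -/
theorem dzetaZero_eq (hB : IsBergmanKernel B) (β : Fin N) {p : S} (hp : C.crit β ≠ p) :
    dzetaZero A B β p = -(velocity (A.chart β).symm 0 * B (C.crit β) p) := by
  have h1 := hB.holomorphic_off_diag _ _ hp
  have h2 : AnalyticAt ℂ (OneForm.pullback (fun q => B q p) (chartAt ℂ (C.crit β)).symm)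
      (chartAt ℂ (C.crit β) (C.crit β)) := by
    have h3 : AnalyticAt ℂ (fun w : ℂ => (w, chartAt ℂ p p)) (chartAt ℂ (C.crit β) (C.crit β)) :=
      analyticAt_id.prod analyticAt_const
    refine (h1.comp_of_eq h3 rfl).congr (Eventually.of_forall fun w => ?_)
    simp only [Function.comp_apply, BiDifferential.coeff, OneForm.pullback,
      (chartAt ℂ p).left_inv (mem_chart_source ℂ p), velocity_chartAt_symm, mul_one]
  have h4 : AnalyticAt ℂ (OneForm.pullback (fun q => B q p) (A.chart β).symm) 0 := by
    refine OneForm.analyticAt_pullback_symm (A.mem_maximalAtlas β)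
      (chartAt_mem_complexAtlas (C.crit β)) (airy_zero_mem_target A β) ?_ ?_
    · rw [airy_symm_zero]; exact mem_chart_source ℂ _
    · rwa [airy_symm_zero]
  rw [dzetaZero, residue_div_self h4, OneForm.pullback, airy_symm_zero, mul_comm]

/-- `dζ^β` in terms of the Bergman kernel expressed in the preferred charts. -/
theorem pullback_dzetaZero_eq_coeff (hB : IsBergmanKernel B) (β : Fin N) (φ :
    OpenPartialHomeomorph S ℂ) {v : ℂ}
    (hv : C.crit β ≠ φ.symm v) :
    (dzetaZero A B β).pullback φ.symm v = -(velocity (A.chart β).symm 0 *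
      B.coeff (chartAt ℂ (C.crit β)) φ (chartAt ℂ (C.crit β) (C.crit β)) v) := by
  rw [OneForm.pullback, dzetaZero_eq A hB β hv, BiDifferential.coeff, velocity_chartAt_symm,
    (chartAt ℂ (C.crit β)).left_inv (mem_chart_source ℂ _)]
  ring

theorem analyticAt_pullback_dzetaZero [T2Space S] (hB : IsBergmanKernel B) (β : Fin N) {φ :
    OpenPartialHomeomorph S ℂ}
    (hφ : φ ∈ IsManifold.maximalAtlas 𝓘(ℂ) ω S) {w : ℂ} (hw : w ∈ φ.target)
    (hp : φ.symm w ≠ C.crit β) :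
    AnalyticAt ℂ ((dzetaZero A B β).pullback φ.symm) w := by
  refine OneForm.analyticAt_pullback_symm hφ (chartAt_mem_complexAtlas (φ.symm w)) hw
    (mem_chart_source ℂ _) ?_
  generalize φ.symm w = p at hp
  have h1 := hB.holomorphic_off_diag _ _ hp.symm
  have h3 : AnalyticAt ℂ (fun v : ℂ => (chartAt ℂ (C.crit β) (C.crit β), v)) (chartAt ℂ p p) :=
    analyticAt_const.prod analyticAt_id
  have h4 : ∀ᶠ v in 𝓝 (chartAt ℂ p p), (chartAt ℂ p).symm v ≠ C.crit β := by
    have hc := (chartAt ℂ p).continuousAt_symm (mem_chart_target ℂ p)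
    refine hc.eventually (isOpen_ne.mem_nhds ?_)
    rwa [(chartAt ℂ p).left_inv (mem_chart_source ℂ p)]
  refine ((analyticAt_const (v := velocity (A.chart β).symm 0)).mul
    (h1.comp_of_eq h3 rfl)).neg.congr ?_
  filter_upwards [h4] with v hv
  rw [pullback_dzetaZero_eq_coeff A hB β _ hv.symm]; rfl

/-- The double pole of `dζ^β` at `z^β`, in the Airy coordinate. -/
theorem pullback_dzetaZero_airy (hB : IsBergmanKernel B) (β : Fin N) : ∃ m :
    ℂ → ℂ, AnalyticAt ℂ m 0 ∧
    ∀ᶠ t in 𝓝[≠] (0 : ℂ), (dzetaZero A B β).pullback (A.chart β).symm t = -1 / t ^ 2 + m t := by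
  set ψ := chartAt ℂ (C.crit β) with hψ
  set a := ψ (C.crit β) with ha
  have h0 := airy_zero_mem_target A β
  have hsrc : (A.chart β).symm 0 ∈ ψ.source := by
    rw [airy_symm_zero]; exact mem_chart_source ℂ _
  set f := ψ ∘ (A.chart β).symm with hf
  have hfa : AnalyticAt ℂ f 0 :=
    analyticAt_transition (A.mem_maximalAtlas β) (chartAt_mem_complexAtlas _) h0 hsrc
  have hf0 : f 0 = a := by simp [hf, ha, airy_symm_zero]
  have hvel : velocity (A.chart β).symm 0 = deriv f 0 := by
    have := velocity_symm (A.mem_source β)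
    rwa [A.chart_crit] at this
  have hf'0 : deriv f 0 ≠ 0 := by
    rw [← hvel]
    have := velocity_symm_ne_zero (A.mem_maximalAtlas β) (A.mem_source β)
    rwa [A.chart_crit] at this
  obtain ⟨h, hh, hpole⟩ := hB.double_pole (C.crit β)
  -- `f'(0) / (f t - f 0) = q t / t`
  set g := dslope f 0 with hg
  have hga : AnalyticAt ℂ g 0 := hfa.dslope_zero
  have hg0 : g 0 = deriv f 0 := dslope_same f 0
  set q : ℂ → ℂ := fun t => g 0 / g t with hq
  have hqa : AnalyticAt ℂ q 0 := analyticAt_const.div hga (hg0 ▸ hf'0)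
  have hq0 : q 0 = 1 := div_self (hg0 ▸ hf'0)
  have hfc : AnalyticAt ℂ (fun t => h (a, f t)) 0 := by
    have h3 : AnalyticAt ℂ (fun t : ℂ => (a, f t)) 0 := analyticAt_const.prod hfa
    exact hh.comp_of_eq h3 (by rw [hf0])
  -- The polar contribution `-f'(0) f'(t) / (f t - f 0)^2` is the derivative of `q / t`. Since `q 0
  -- = 1`, `q / t` is `1 / t` plus the difference quotient of `q`, so its derivative is `-1 / t^2 +
  -- derivDslope q`: there is no `1 / t` term.
  refine ⟨fun t => derivDslope q t - deriv f 0 * deriv f t * h (a, f t), hqa.derivDslope.sub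
    ((analyticAt_const.mul hfa.deriv).mul hfc), ?_⟩
  have e1 : ∀ᶠ t in 𝓝 (0 : ℂ), a ≠ f t →
      B.coeff ψ ψ a (f t) = 1 / (a - f t) ^ 2 + h (a, f t) := by
    have h3 : Tendsto (fun t : ℂ => (a, f t)) (𝓝 0) (𝓝 (a, a)) := by
      have := (continuousAt_const (y := a)).prodMk hfa.continuousAt
      rwa [ContinuousAt, hf0] at this
    exact h3.eventually hpole
  have e2 : ∀ᶠ t in 𝓝 (0 : ℂ), g t ≠ 0 :=
    hga.continuousAt.eventually_ne (hg0 ▸ hf'0)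
  have e3 : ∀ᶠ t in 𝓝 (0 : ℂ), t ∈ (A.chart β).target :=
    (A.chart β).open_target.mem_nhds h0
  have e4 := eventually_symm_mem_source h0 hsrc
  rw [eventually_nhdsWithin_iff]
  filter_upwards [e1, e2, e3, e4, hqa.dslope_zero.eventually_analyticAt,
    hga.eventually_analyticAt, hqa.eventually_analyticAt] with t h1 h2 h3 h4 h5 h6 h7 ht
  have ht0 : t ≠ 0 := ht
  have hft : f t = a + t * g t := by rw [← hf0]; exact eq_add_mul_dslope f t
  have hne : a ≠ f t := by
    rw [hft]; intro h8
    exact mul_ne_zero ht0 h2 (by simpa using h8.symm)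
  have hcrit : C.crit β ≠ ψ.symm (f t) := by
    have h9 : ψ.symm (f t) = (A.chart β).symm t := ψ.left_inv h4
    rw [h9]; exact (airy_symm_ne_crit A h3 ht0).symm
  rw [OneForm.pullback_symm_eq _ (A.mem_maximalAtlas β) (chartAt_mem_complexAtlas (C.crit β)) h3 h4]
  change (dzetaZero A B β).pullback ψ.symm (f t) * deriv f t = _
  rw [pullback_dzetaZero_eq_coeff A hB β ψ hcrit, h1 hne, hvel]
  -- derivatives of both expressions for `q`
  have d1 : HasDerivAt f (1 * g t + t * deriv g t) t := by
    have h3 : f = fun t => f 0 + t * g t := funext (eq_add_mul_dslope f)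
    rw [h3]
    exact ((hasDerivAt_id t).mul h6.differentiableAt.hasDerivAt).const_add _
  have d2 : HasDerivAt q (1 * dslope q 0 t + t * derivDslope q t) t := by
    have := ((hasDerivAt_id t).mul h5.differentiableAt.hasDerivAt).const_add (q 0)
    exact this.congr_of_eventuallyEq (Eventually.of_forall (eq_add_mul_dslope q))
  have d3 : HasDerivAt q ((0 * g t - g 0 * deriv g t) / g t ^ 2) t :=
    (hasDerivAt_const t (g 0)).div h6.differentiableAt.hasDerivAt h2
  have d4 := d2.unique d3
  rw [dslope_zero_of_ne q ht0, hq0] at d4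
  have d5 : derivDslope q t = (-(g 0 * deriv g t) / g t ^ 2 - (g 0 / g t - 1) / t) / t := by
    rw [eq_div_iff ht0]
    have : q t = g 0 / g t := rfl
    rw [this] at d4
    linear_combination d4
  rw [d5, d1.deriv, hft, ← hg0]
  field_simp
  ring

end Zeta

end SpectralCurve

namespace SpectralCurve

variable {S : Type*} [TopologicalSpace S] [ChartedSpace ℂ S] [IsManifold 𝓘(ℂ) ω S] [T2Space S]
  {N : ℕ} {C : SpectralCurve S N}

/-! ### The regular part of `dζ^β` on an Airy disc. -/

section RegularPart

variable (A : AiryCoordinates C) {B : BiDifferential S}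

/-- The expansion `dζ^β = (-δ_{βγ} / t^2 + h) dt` in the Airy coordinate at `z^γ`. -/
theorem exists_regularPart (hB : IsBergmanKernel B) (β γ : Fin N) {ρ : ℝ}
    (hsub : Metric.ball 0 ρ ⊆ (A.chart γ).target) :
    ∃ h : ℂ → ℂ, DifferentiableOn ℂ h (Metric.ball 0 ρ) ∧ ∀ t ∈ Metric.ball (0 : ℂ) ρ, t ≠ 0 →
      (dzetaZero A B β).pullback (A.chart γ).symm t =
        -(if β = γ then 1 else 0) / t ^ 2 + h t := by
  set δ : ℂ := if β = γ then 1 else 0 with hδ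
  set z := (dzetaZero A B β).pullback (A.chart γ).symm with hz
  have h0 := airy_zero_mem_target A γ
  obtain ⟨m, hm, hme⟩ : ∃ m : ℂ → ℂ, AnalyticAt ℂ m 0 ∧
      ∀ᶠ t in 𝓝[≠] (0 : ℂ), z t = -δ / t ^ 2 + m t := by
    by_cases hβγ : β = γ
    · subst hβγ
      obtain ⟨m, hm, hme⟩ := pullback_dzetaZero_airy A hB β
      exact ⟨m, hm, by simpa [hδ] using hme⟩
    · refine ⟨z, ?_, Eventually.of_forall fun t => by simp [hδ, hβγ]⟩
      refine analyticAt_pullback_dzetaZero A hB β (A.mem_maximalAtlas γ) h0 ?_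
      rw [airy_symm_zero]
      exact fun h => hβγ (C.crit_injective h).symm
  have hball : ∀ t ∈ Metric.ball (0 : ℂ) ρ, t ≠ 0 → AnalyticAt ℂ z t := fun t ht ht0 =>
    analyticAt_pullback_dzetaZero A hB β (A.mem_maximalAtlas γ) (hsub ht)
      (airy_symm_ne_crit A (hsub ht) ht0)
  -- Off the origin the regular part is forced; at the origin the local expansion supplies the value
  -- that removes the singularity. Working on the whole ball rather than with a germ is what the
  -- integral along the indentation needs.
  refine ⟨Function.update (fun t => z t + δ / t ^ 2) 0 (m 0), fun t ht => ?_, fun t _ ht0 => ?_⟩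
  · refine DifferentiableAt.differentiableWithinAt ?_
    rcases eq_or_ne t 0 with rfl | ht0
    · refine hm.differentiableAt.congr_of_eventuallyEq ?_
      filter_upwards [eventually_nhdsWithin_iff.1 hme] with s hs
      rcases eq_or_ne s 0 with rfl | hs0
      · simp
      · rw [Function.update_of_ne hs0, hs hs0]; ring
    · have h1 : DifferentiableAt ℂ (fun t => z t + δ / t ^ 2) t :=
        (hball t ht ht0).differentiableAt.add
          ((differentiableAt_const _).div (differentiableAt_id.pow 2) (pow_ne_zero 2 ht0))
      refine h1.congr_of_eventuallyEq ?_
      filter_upwards [isOpen_ne.mem_nhds ht0] with s hs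
      rw [Function.update_of_ne hs]
  · rw [Function.update_of_ne ht0]; ring

end RegularPart

/-! ### The operator `-d ∘ (1/dx)` and the defect of homogeneity. -/

section Descend

/-- The quotient `α / dx` in a chart. -/
theorem div_differential_x_comp_symm (α : OneForm S) {φ : OpenPartialHomeomorph S ℂ}
    (hφ : φ ∈ IsManifold.maximalAtlas 𝓘(ℂ) ω S) {w : ℂ} (hw : w ∈ φ.target)
    (hp : φ.symm w ∉ C.bdry) :
    (fun p => α p / differential C.x p) ∘ φ.symm =ᶠ[𝓝 w]
      fun v => α.pullback φ.symm v / deriv (C.x ∘ φ.symm) v := by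
  filter_upwards [φ.open_target.mem_nhds hw,
    (φ.continuousAt_symm hw).eventually (C.isOpen_compl_bdry.mem_nhds hp)] with v hv hv'
  rw [Function.comp_apply, OneForm.div_eq_pullback_div _ _ hφ hv, pullback_differential_x hφ hv hv']

/-- The operator is defined with the preferred chart at each point; because `α / dx` is a function,
the result may be computed in any chart, away from the poles and zeros of `dx`. -/
theorem pullback_descend {α : OneForm S} {φ : OpenPartialHomeomorph S ℂ}
    (hφ : φ ∈ IsManifold.maximalAtlas 𝓘(ℂ) ω S) {w : ℂ} (hw : w ∈ φ.target)
    (hp : φ.symm w ∉ C.bdry) (hp' : φ.symm w ∉ range C.crit)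
    (hα : AnalyticAt ℂ (α.pullback φ.symm) w) :
    (C.descend α).pullback φ.symm w =
      -deriv (fun v => α.pullback φ.symm v / deriv (C.x ∘ φ.symm) v) w := by
  have h1 := div_differential_x_comp_symm α hφ hw hp
  have h2 : DifferentiableAt ℂ (fun v => α.pullback φ.symm v / deriv (C.x ∘ φ.symm) v) w :=
    hα.differentiableAt.div (analyticAt_x hφ hw hp).deriv.differentiableAt
      (deriv_x_ne_zero hφ hw hp hp')
  have h3 := pullback_differential hφ hw (h2.congr_of_eventuallyEq h1)
  rw [h1.deriv_eq] at h3
  rw [← h3, descend, OneForm.pullback, OneForm.pullback, Pi.neg_apply, neg_mul]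

variable (A : AiryCoordinates C) (B : BiDifferential S)

/-- The one-form `(x - x^β) dζ_1^β - ∑ c_γ dζ_0^γ`. -/
noncomputable def defectForm (β : Fin N) (c : Fin N → ℂ) : OneForm S := fun p =>
  (C.x p - C.x (C.crit β)) * dzeta A B 1 β p - ∑ γ, c γ * dzeta A B 0 γ p

variable {B}

/-- Division by `dx` turns the defect form into a function on `S`, to which Liouville's theorem can
be applied. -/
theorem defectForm_div_comp_symm (hB : IsBergmanKernel B) (β : Fin N) (c : Fin N → ℂ)
    {φ : OpenPartialHomeomorph S ℂ}
    (hφ : φ ∈ IsManifold.maximalAtlas 𝓘(ℂ) ω S) {w : ℂ} (hw : w ∈ φ.target)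
    (hp : φ.symm w ∉ C.bdry) (hp' : φ.symm w ∉ range C.crit) :
    defectForm A B β c (φ.symm w) / differential C.x (φ.symm w) =
      ((C.x (φ.symm w) - C.x (C.crit β)) *
          -deriv (fun v => (dzetaZero A B β).pullback φ.symm v / deriv (C.x ∘ φ.symm) v) w -
        ∑ γ, c γ * (dzetaZero A B γ).pullback φ.symm w) / deriv (C.x ∘ φ.symm) w := by
  have hα := analyticAt_pullback_dzetaZero A hB β hφ hw fun h => hp' ⟨β, h.symm⟩
  rw [OneForm.div_eq_pullback_div _ _ hφ hw, pullback_differential_x hφ hw hp,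
    ← pullback_descend hφ hw hp hp' hα]
  congr 1
  simp only [OneForm.pullback, defectForm, dzeta, Function.iterate_one, Function.iterate_zero, id,
    sub_mul, Finset.sum_mul, mul_assoc]

end Descend

/-! ### Division by `dx` at the boundary points. -/

section Pole

/-- Near a pole of `x` one has `x = 1 / v` and `dx = -1 / (q v)` with `q = v / v'` holomorphic and
vanishing at the pole. -/
theorem exists_pole_form {X : ℂ → ℂ} {a : ℂ} (hX : MeromorphicAt X a)
    (hneg : meromorphicOrderAt X a < 0) :
    ∃ v q : ℂ → ℂ, AnalyticAt ℂ v a ∧ AnalyticAt ℂ q a ∧ q a = 0 ∧ ∀ᶠ w in 𝓝[≠] a,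
      v w ≠ 0 ∧ q w ≠ 0 ∧ q w * deriv v w = v w ∧ X w = 1 / v w ∧
        deriv X w = -1 / (q w * v w) := by
  obtain ⟨k, hk⟩ := WithTop.ne_top_iff_exists.1 hneg.ne_top
  obtain ⟨n, hn⟩ : ∃ n : ℕ, k = -((n : ℤ) + 1) := by
    rw [← hk] at hneg
    have : k < 0 := by exact_mod_cast hneg
    exact ⟨(-k - 1).toNat, by omega⟩
  obtain ⟨g, hg, hg0, he⟩ := (meromorphicOrderAt_eq_int_iff hX).1 hk.symm
  set G : ℂ → ℂ := fun w => (g w)⁻¹ with hG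
  have hGa : AnalyticAt ℂ G a := hg.inv hg0
  have hG0 : G a ≠ 0 := inv_ne_zero hg0
  have hsub : AnalyticAt ℂ (fun w : ℂ => w - a) a := analyticAt_id.sub analyticAt_const
  set d : ℂ → ℂ := fun w => (n + 1) * G w + (w - a) * deriv G w with hd
  have hda : AnalyticAt ℂ d a := (analyticAt_const.mul hGa).add (hsub.mul hGa.deriv)
  have hd0 : d a ≠ 0 := by
    simp only [hd, sub_self, zero_mul, add_zero]
    exact mul_ne_zero (Nat.cast_add_one_ne_zero n) hG0
  -- Here `n + 1` is the order of the pole and `G` the inverse of its leading unit. Then `v' = (w -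
  -- a)^n d` with `d a = (n + 1) G a ≠ 0`, so `v / v'` has a simple zero whatever the order.
  refine ⟨fun w => (w - a) ^ (n + 1) * G w, fun w => (w - a) * G w / d w,
    (hsub.pow _).mul hGa, (hsub.mul hGa).div hda hd0, by simp, ?_⟩
  have e1 : ∀ᶠ w in 𝓝 a, g w ≠ 0 := hg.continuousAt.eventually_ne hg0
  have e2 : ∀ᶠ w in 𝓝 a, d w ≠ 0 := hda.continuousAt.eventually_ne hd0
  have e3 := eventually_eventually_nhds.2 (eventually_nhdsWithin_iff.1 he)
  rw [eventually_nhdsWithin_iff]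
  filter_upwards [e1, e2, e3, hGa.eventually_analyticAt, e1.eventually_nhds]
    with w h1 h2 h3 h4 h5 hwa
  have hw : w - a ≠ 0 := sub_ne_zero.2 hwa
  have hGw : G w ≠ 0 := inv_ne_zero h1
  have hv : (w - a) ^ (n + 1) * G w ≠ 0 := mul_ne_zero (pow_ne_zero _ hw) hGw
  have d1 : HasDerivAt (fun w => (w - a) ^ (n + 1) * G w) ((w - a) ^ n * d w) w := by
    have := (((hasDerivAt_id w).sub_const a).pow (n + 1)).mul h4.differentiableAt.hasDerivAt
    refine this.congr_deriv ?_
    simp only [hd, id, Pi.pow_apply]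
    push_cast [Nat.add_sub_cancel]
    ring
  have hXw : X =ᶠ[𝓝 w] fun w => 1 / ((w - a) ^ (n + 1) * G w) := by
    filter_upwards [h3, isOpen_ne.mem_nhds hwa, h5] with s hs hsa hgs
    rw [hs hsa, hn, smul_eq_mul, zpow_neg, hG]
    have : s - a ≠ 0 := sub_ne_zero.2 hsa
    norm_cast
    field_simp
  refine ⟨hv, div_ne_zero (mul_ne_zero hw hGw) h2, ?_, hXw.self_of_nhds, ?_⟩
  · rw [d1.deriv]; field_simp; ring
  · rw [hXw.deriv_eq]
    have := (d1.inv hv)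
    simp only [one_div]
    erw [this.deriv]
    field_simp
    ring

/-- The quotient of a holomorphic form by `dx` extends holomorphically off the critical points. -/
theorem exists_analytic_div_differential_x {α : OneForm S} {p : S} (hp : p ∉ range C.crit)
    (hα : AnalyticAt ℂ (α.pullback (chartAt ℂ p).symm) (chartAt ℂ p p)) :
    ∃ h : ℂ → ℂ, AnalyticAt ℂ h (chartAt ℂ p p) ∧
      (fun p => α p / differential C.x p) ∘ (chartAt ℂ p).symm =ᶠ[𝓝[≠] (chartAt ℂ p p)] h := by
  have hs := mem_chart_source ℂ p
  have hφ := chartAt_mem_complexAtlas p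
  by_cases hb : p ∈ C.bdry
  · obtain ⟨v, q, hv, hq, -, he⟩ := exists_pole_form (C.pole_x p hb).1 (C.pole_x p hb).2
    refine ⟨fun w => -(α.pullback (chartAt ℂ p).symm w * (q w * v w)),
      (hα.mul (hq.mul hv)).neg, ?_⟩
    filter_upwards [he, C.eventually_notMem_special hs] with w ⟨h1, h2, _, _, h5⟩ ⟨h6, h7, _⟩
    rw [(div_differential_x_comp_symm α hφ h6 h7).self_of_nhds]
    simp only [h5]
    field_simp
  · have hp1 : (chartAt ℂ p).symm (chartAt ℂ p p) ∉ C.bdry := by rwa [(chartAt ℂ p).left_inv hs]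
    have hp2 : (chartAt ℂ p).symm (chartAt ℂ p p) ∉ range C.crit := by
      rwa [(chartAt ℂ p).left_inv hs]
    have ht := mem_chart_target ℂ p
    exact ⟨_, hα.div (analyticAt_x hφ ht hp1).deriv (deriv_x_ne_zero hφ ht hp1 hp2),
      (div_differential_x_comp_symm α hφ ht hp1).filter_mono nhdsWithin_le_nhds⟩

end Pole

end SpectralCurve

namespace SpectralCurve

variable {S : Type*} [TopologicalSpace S] [ChartedSpace ℂ S] [IsManifold 𝓘(ℂ) ω S]
  {N : ℕ} {C : SpectralCurve S N} {A : AiryCoordinates C} {γ : Fin N}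

/-! ### Estimates along a Lefschetz thimble. -/

section Thimble

/-- The pullback of a one-form to a thimble is `t • (α / dx)`. -/
theorem LefschetzThimble.pullback_path (L : LefschetzThimble A γ) (α : OneForm S) {t : ℝ}
    (ht : t ∈ interior L.dom) (ht0 : t ≠ 0) :
    α.pullback L.path t = t * (α (L.path t) / differential C.x (L.path t)) := by
  have htd := interior_subset ht
  have hb := L.notMem_bdry t htd
  have hc := L.notMem_crit t htd ht0
  set p := L.path t with hp
  set φ := chartAt ℂ p with hφdef
  have hφ : φ ∈ IsManifold.maximalAtlas 𝓘(ℂ) ω S := chartAt_mem_complexAtlas p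
  have hs : p ∈ φ.source := mem_chart_source ℂ p
  have hw := φ.map_source hs
  have hps : φ.symm (φ p) = p := φ.left_inv hs
  have hdom : L.dom ∈ 𝓝 t := mem_interior_iff_mem_nhds.1 ht
  have hcont : ContinuousAt L.path t := L.continuousOn_path.continuousAt hdom
  have hX : AnalyticAt ℂ (C.x ∘ φ.symm) (φ p) := analyticAt_x hφ hw (by rwa [hps])
  have hX0 : deriv (C.x ∘ φ.symm) (φ p) ≠ 0 :=
    deriv_x_ne_zero hφ hw (by rwa [hps]) (by rwa [hps])
  have hsd : HasStrictDerivAt (C.x ∘ φ.symm) (deriv (C.x ∘ φ.symm) (φ p)) (φ p) :=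
    hX.hasStrictDerivAt
  -- Thimbles are only assumed continuous. Off the critical points `x` is a local coordinate, and
  -- the path is its local inverse applied to `x^γ + t^2/2`, which makes it differentiable with
  -- velocity `t / x'`.
  set ℓ := hsd.localInverse _ _ _ hX0 with hℓ
  have hℓd : HasDerivAt ℓ (deriv (C.x ∘ φ.symm) (φ p))⁻¹ ((C.x ∘ φ.symm) (φ p)) :=
    (hsd.to_localInverse hX0).hasDerivAt
  have hℓl : ∀ᶠ w in 𝓝 (φ p), ℓ ((C.x ∘ φ.symm) w) = w :=
    HasStrictFDerivAt.eventually_left_inverse _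
  have hφp : ContinuousAt (φ ∘ L.path) t := ContinuousAt.comp (φ.continuousAt hs) hcont
  have hxp : (C.x ∘ φ.symm) (φ p) = C.x (C.crit γ) + (t : ℂ) ^ 2 / 2 := by
    rw [Function.comp_apply, hps, hp, L.x_path t htd]
  have heq : φ ∘ L.path =ᶠ[𝓝 t] fun s : ℝ => ℓ (C.x (C.crit γ) + (s : ℂ) ^ 2 / 2) := by
    filter_upwards [hφp.eventually hℓl, hdom,
      hcont.eventually (φ.open_source.mem_nhds hs)] with s h1 h2 h3
    rw [← L.x_path s h2]
    conv_lhs => rw [← h1]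
    simp [φ.left_inv h3]
  have hq : HasDerivAt (fun s : ℝ => C.x (C.crit γ) + (s : ℂ) ^ 2 / 2) (t : ℂ) t := by
    have := (((hasDerivAt_pow 2 (t : ℂ)).div_const 2).const_add (C.x (C.crit γ))).comp_ofReal
    simpa using this
  have hd : HasDerivAt (φ ∘ L.path) ((t : ℂ) • (deriv (C.x ∘ φ.symm) (φ p))⁻¹) t := by
    refine HasDerivAt.congr_of_eventuallyEq ?_ heq
    refine HasDerivAt.scomp t ?_ hq
    rwa [← hxp]
  rw [α.pullback_eq_mul_deriv hφ hcont hs hd.differentiableAt, hd.deriv]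
  have hdiv := OneForm.div_eq_pullback_div α (differential C.x) hφ hw
  rw [pullback_differential_x hφ hw (by rwa [hps]), hps] at hdiv
  rw [hdiv, smul_eq_mul]
  ring

variable [T2Space S] [CompactSpace S]

/-- The quotient `α / dx` is bounded along a thimble, away from the critical point. -/
theorem LefschetzThimble.exists_bound (L : LefschetzThimble A γ) {α : OneForm S}
    (hα : ∀ p, p ∉ range C.crit → AnalyticAt ℂ (α.pullback (chartAt ℂ p).symm) (chartAt ℂ p p)) :
    ∃ M : ℝ, 0 ≤ M ∧ ∀ t ∈ L.dom, L.rad ≤ |t| →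
      ‖α (L.path t) / differential C.x (L.path t)‖ ≤ M := by
  have key : ∃ M : ℝ, ∀ t ∈ L.dom, L.rad ≤ |t| → L.path t ∈ (univ : Set S) →
      ‖α (L.path t) / differential C.x (L.path t)‖ ≤ M := by
    -- An unbounded thimble is controlled through the compactness of `S`: it suffices to bound the
    -- quotient on the part of the path inside some neighbourhood of each point `s` of `S`.
    refine isCompact_univ.induction_on (p := fun U => ∃ M : ℝ, ∀ t ∈ L.dom, L.rad ≤ |t| →
      L.path t ∈ U → ‖α (L.path t) / differential C.x (L.path t)‖ ≤ M) ⟨0, by simp⟩ ?_ ?_ ?_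
    · rintro U V hUV ⟨M, hM⟩
      exact ⟨M, fun t h1 h2 h3 => hM t h1 h2 (hUV h3)⟩
    · rintro U V ⟨M, hM⟩ ⟨M', hM'⟩
      refine ⟨max M M', fun t h1 h2 h3 => ?_⟩
      rcases h3 with h3 | h3
      exacts [(hM t h1 h2 h3).trans (le_max_left _ _), (hM' t h1 h2 h3).trans (le_max_right _ _)]
    · intro s _
      rw [nhdsWithin_univ]
      by_cases hs : s ∈ range C.crit
      · have hsb : s ∉ C.bdry := ((C.mem_range_crit_iff _).1 hs).1
        have hxc : ContinuousAt C.x s := (C.holomorphic_x s hsb).continuousAt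
        have hU1 : ∀ᶠ p in 𝓝 s, ‖C.x p‖ < ‖C.x s‖ + 1 :=
          hxc.norm.eventually_lt continuousAt_const (by simp)
        -- Near a critical point `s` the function `x` is bounded, so only parameters with `|t| ≤ T`
        -- can come there. Those with `|t| ≥ rad` sweep out a compact set missing `s`, so a small
        -- neighbourhood of `s` is not visited at all and the bound is vacuous.
        set T : ℝ := 2 * (‖C.x s‖ + 1 + ‖C.x (C.crit γ)‖) + 1 with hT
        set K : Set ℝ := L.dom ∩ ({t | L.rad ≤ |t|} ∩ Icc (-T) T) with hK
        have hKc : IsCompact K := by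
          refine IsCompact.inter_left ?_ L.isClosed_dom
          exact isCompact_Icc.inter_left (isClosed_le continuous_const continuous_abs)
        have hKi : IsCompact (L.path '' K) :=
          hKc.image_of_continuousOn (L.continuousOn_path.mono inter_subset_left)
        have hsK : s ∉ L.path '' K := by
          rintro ⟨t, ht, rfl⟩
          refine L.notMem_crit t ht.1 ?_ hs
          rintro rfl
          have h1 : L.rad ≤ |(0 : ℝ)| := ht.2.1
          rw [abs_zero] at h1
          exact absurd L.rad_pos (not_lt.2 h1)
        refine ⟨_, inter_mem hU1 (hKi.isClosed.isOpen_compl.mem_nhds hsK), 0, fun t h1 h2 h3 => ?_⟩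
        exfalso
        refine h3.2 ⟨t, ⟨h1, h2, ?_⟩, rfl⟩
        have h4 : ‖C.x (L.path t)‖ < ‖C.x s‖ + 1 := h3.1
        have h5 : ‖(t : ℂ) ^ 2 / 2‖ ≤ ‖C.x s‖ + 1 + ‖C.x (C.crit γ)‖ := by
          have : (t : ℂ) ^ 2 / 2 = C.x (L.path t) - C.x (C.crit γ) := by
            rw [L.x_path t h1]; ring
          rw [this]
          exact (norm_sub_le _ _).trans (by linarith)
        rw [norm_div, norm_pow, Complex.norm_real, Real.norm_eq_abs, sq_abs, Complex.norm_two] at h5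
        rw [mem_Icc, ← abs_le]
        have h6 := norm_nonneg (C.x s)
        have h7 := norm_nonneg (C.x (C.crit γ))
        refine abs_le_of_sq_le_sq ?_ (by positivity)
        nlinarith
      · obtain ⟨h, ha, he⟩ := exists_analytic_div_differential_x hs (hα s hs)
        have hsrc := mem_chart_source ℂ s
        have h1 : ∀ᶠ w in 𝓝 (chartAt ℂ s s), ‖h w‖ < ‖h (chartAt ℂ s s)‖ + 1 :=
          ha.continuousAt.norm.eventually_lt continuousAt_const (by simp)
        have h2 := ((chartAt ℂ s).continuousAt hsrc).eventually
          (h1.and (eventually_nhdsWithin_iff.1 he))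
        -- The holomorphic extension agrees with the quotient only off `s`, so the value at `s`
        -- itself is added to the bound.
        refine ⟨_, inter_mem h2 ((chartAt ℂ s).open_source.mem_nhds hsrc),
          max ‖α s / differential C.x s‖ (‖h (chartAt ℂ s s)‖ + 1), fun t _ _ h3 => ?_⟩
        obtain ⟨⟨h4, h5⟩, h6⟩ := h3
        by_cases hts : L.path t = s
        · rw [hts]; exact le_max_left _ _
        · refine le_max_of_le_right ?_
          have h7 := h5 (fun h8 => hts ((chartAt ℂ s).injOn h6 hsrc h8))
          simp only [Function.comp_apply, (chartAt ℂ s).left_inv h6] at h7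
          rw [h7]; exact h4.le
  obtain ⟨M, hM⟩ := key
  exact ⟨|M|, abs_nonneg M, fun t h1 h2 => (hM t h1 h2 (mem_univ _)).trans (le_abs_self M)⟩

theorem exp_mul_exp_eq_gaussFactor {a b : ℂ} {t : ℂ} (u : ℝ) (h : b = a + t ^ 2 / 2) :
    Complex.exp (a / u) * Complex.exp (-b / u) = gaussFactor u t := by
  rw [← Complex.exp_add, gaussFactor, h]
  congr 1
  rw [neg_add, add_div, ← add_assoc, neg_div, add_neg_cancel, zero_add, ← neg_div, div_div]

/-- The part of a thimble outside the indentation contributes only a flat function. -/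
theorem LefschetzThimble.isFlat_far (L : LefschetzThimble A γ) {α : OneForm S}
    (hα : ∀ p, p ∉ range C.crit → AnalyticAt ℂ (α.pullback (chartAt ℂ p).symm) (chartAt ℂ p p)) :
    IsFlat fun u => ∫ t in L.dom \ Icc (-L.rad) L.rad, Complex.exp (C.x (C.crit γ) / u) *
      (Complex.exp (-C.x (L.path t) / u) * α.pullback L.path t) := by
  obtain ⟨M, hM0, hM⟩ := L.exists_bound hα
  refine isFlat_setIntegral_far L.rad_pos (L.isClosed_dom.measurableSet.diff measurableSet_Icc)
    hM0 fun u hu => ?_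
  -- The formula for the velocity holds in the interior of the parameter interval; the endpoints
  -- form a null set.
  have hfr : MeasureTheory.volume (frontier L.dom) = 0 :=
    L.ordConnected_dom.convex.addHaar_frontier _
  filter_upwards [MeasureTheory.measure_eq_zero_iff_ae_notMem.1 hfr] with t ht hts
  have hti : t ∈ interior L.dom := by
    by_contra hcon
    exact ht ⟨subset_closure hts.1, hcon⟩
  have hrt : L.rad ≤ |t| := by
    rw [le_abs]
    by_contra hcon
    push Not at hcon
    exact hts.2 ⟨by linarith, hcon.1.le⟩
  have ht0 : t ≠ 0 := by
    rintro rfl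
    rw [abs_zero] at hrt
    exact absurd L.rad_pos (not_lt.2 hrt)
  refine ⟨hrt, ?_⟩
  rw [← mul_assoc, exp_mul_exp_eq_gaussFactor u (L.x_path t hts.1), norm_mul,
    norm_gaussFactor_ofReal, L.pullback_path α hti ht0, norm_mul, Complex.norm_real,
    Real.norm_eq_abs, mul_comm]
  have := hM t hts.1 hrt
  refine mul_le_mul_of_nonneg_right ?_ (Real.exp_nonneg _)
  nlinarith [abs_nonneg t]

end Thimble

/-! ### Existence of the `R`-matrix and its coefficients. -/

section RMatrix

variable [T2Space S] [CompactSpace S] (A) {B : BiDifferential S}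

/-- The `R`-matrix in terms of the regular parts `h` of the forms `dζ^β` at the critical points. -/
noncomputable def rMatrixOfRegularParts (h : Fin N → Fin N → ℂ → ℂ) : ℕ → Matrix (Fin N) (Fin N) ℂ
  | 0 => 1
  | k + 1 => Matrix.of fun β γ => (-1) ^ (k + 1) * derivDslope^[k] (h β γ) 0

/-- After multiplication by `e^{x^γ/u}` the indentation becomes a Gaussian integral along the upper
half circle, with an explicit value, and the remainder of the thimble is flat. The prefactor `u /
√(2πu)` turns the `δ/u` of the double pole into `c 0` and shifts the Watson coefficients of `h` by
one. -/
theorem LefschetzThimble.isBigO_integral (hB : IsBergmanKernel B) (L : LefschetzThimble A γ)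
    (β : Fin N) {ρ : ℝ} (hρ : L.rad < ρ) (hsub : Metric.ball 0 ρ ⊆ (A.chart γ).target) {h : ℂ → ℂ}
    (hh : DifferentiableOn ℂ h (Metric.ball 0 ρ)) {δ : ℂ}
    (hz : ∀ t ∈ Metric.ball (0 : ℂ) ρ, t ≠ 0 →
      (dzetaZero A B β).pullback (A.chart γ).symm t = -δ / t ^ 2 + h t)
    (c : ℕ → ℂ) (hc0 : c 0 = δ) (hc : ∀ k, c (k + 1) = (-1) ^ (k + 1) * derivDslope^[k] h 0)
    (n : ℕ) :
    (fun u : ℝ => Complex.exp (C.x (C.crit γ) / u) *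
      (((u / √(2 * Real.pi * u) : ℝ) : ℂ) * L.integral (dzetaZero A B β) u) -
        ∑ k ∈ Finset.range n, c k * (-(u : ℂ)) ^ k) =O[𝓝[>] (0 : ℝ)] fun u : ℝ => u ^ n := by
  have hα : ∀ p, p ∉ range C.crit →
      AnalyticAt ℂ ((dzetaZero A B β).pullback (chartAt ℂ p).symm) (chartAt ℂ p p) := by
    intro p hp
    refine analyticAt_pullback_dzetaZero A hB β (chartAt_mem_complexAtlas p)
      (mem_chart_target ℂ p) ?_
    rw [(chartAt ℂ p).left_inv (mem_chart_source ℂ p)]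
    exact fun h => hp ⟨β, h.symm⟩
  have hE := (L.isFlat_far hα).add ((isFlat_gaussFactor L.rad_pos).const_mul (2 * δ / L.rad))
  refine (isBigO_gaussian_expansion L.rad_pos hρ hh δ hE (I := fun u =>
    Complex.exp (C.x (C.crit γ) / u) * L.integral (dzetaZero A B β) u) (fun u hu => ?_)
    c hc0 hc n).congr_left fun u => by ring
  have hcirc : ∀ θ : ℝ, circleMap 0 L.rad θ ∈ Metric.ball (0 : ℂ) ρ := fun θ => by
    rw [mem_ball_zero_iff, norm_circleMap_zero, abs_of_pos L.rad_pos]; exact hρ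
  have hcne : ∀ θ : ℝ, circleMap 0 L.rad θ ≠ 0 := fun θ => circleMap_ne_center L.rad_pos.ne'
  have hsemi := integral_upper_half_circle L.rad_pos hρ hu hh δ
  have hint : ∀ θ : ℝ, Complex.exp (C.x (C.crit γ) / u) *
      (Complex.exp (-C.x ((A.chart γ).symm (circleMap 0 L.rad θ)) / u) *
        (dzetaZero A B β).pullback (fun θ' : ℝ => (A.chart γ).symm (circleMap 0 L.rad θ')) θ) =
      gaussFactor u (circleMap 0 L.rad θ) * ((-δ / circleMap 0 L.rad θ ^ 2 +
        h (circleMap 0 L.rad θ)) * (circleMap 0 L.rad θ * Complex.I)) := by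
    intro θ
    have ht := hsub (hcirc θ)
    have hcont : ContinuousAt (fun θ' : ℝ => (A.chart γ).symm (circleMap 0 L.rad θ')) θ :=
      ContinuousAt.comp (f := circleMap 0 L.rad) ((A.chart γ).continuousAt_symm ht)
        (continuous_circleMap 0 L.rad).continuousAt
    have hcomp : (A.chart γ) ∘ (fun θ' : ℝ => (A.chart γ).symm (circleMap 0 L.rad θ')) =
        circleMap 0 L.rad := by
      ext θ'
      exact (A.chart γ).right_inv (hsub (hcirc θ'))
    rw [← mul_assoc, exp_mul_exp_eq_gaussFactor u (x_airy_symm A ht),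
      OneForm.pullback_eq_mul_deriv _ (A.mem_maximalAtlas γ) hcont ((A.chart γ).map_target ht)
        (by rw [hcomp]; exact differentiable_circleMap 0 L.rad θ), hcomp, deriv_circleMap,
      (A.chart γ).right_inv ht, hz _ (hcirc θ) (hcne θ)]
  rw [LefschetzThimble.integral, mul_add, ← MeasureTheory.integral_const_mul,
    ← intervalIntegral.integral_const_mul, intervalIntegral.integral_congr fun θ _ => hint θ, hsemi]
  ring

/-- The closed disc of indentation is compact inside the open target of the Airy chart, so a
slightly larger ball still fits. The regular parts on these balls then determine all asymptotic
coefficients at once. -/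
theorem exists_regularParts (hB : IsBergmanKernel B) (L : ∀ γ, LefschetzThimble A γ) :
    ∃ h : Fin N → Fin N → ℂ → ℂ, (∀ β γ, AnalyticAt ℂ (h β γ) 0) ∧
      (∀ β γ, ∀ᶠ t in 𝓝[≠] (0 : ℂ), (dzetaZero A B β).pullback (A.chart γ).symm t =
        -(if β = γ then 1 else 0) / t ^ 2 + h β γ t) ∧
      IsRMatrix B L (rMatrixOfRegularParts h) := by
  have h1 : ∀ γ, ∃ ρ, (L γ).rad < ρ ∧ Metric.ball 0 ρ ⊆ (A.chart γ).target := by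
    intro γ
    obtain ⟨ε, hε, hsub⟩ := (isCompact_closedBall (0 : ℂ) (L γ).rad).exists_thickening_subset_open
      (A.chart γ).open_target (L γ).closedBall_subset
    refine ⟨ε + (L γ).rad, by linarith, ?_⟩
    rwa [thickening_closedBall hε (L γ).rad_pos.le] at hsub
  choose ρ hρ hsub using h1
  choose h hd hz using fun β γ => exists_regularPart A hB β γ (hsub γ)
  have hball : ∀ γ, Metric.ball (0 : ℂ) (ρ γ) ∈ 𝓝 (0 : ℂ) := fun γ =>
    Metric.ball_mem_nhds _ ((L γ).rad_pos.trans (hρ γ))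
  refine ⟨h, fun β γ => (hd β γ).analyticAt (hball γ), fun β γ => ?_, fun β γ n => ?_⟩
  · filter_upwards [self_mem_nhdsWithin, mem_nhdsWithin_of_mem_nhds (hball γ)] with t ht ht'
    exact hz β γ t ht' ht
  · exact (L γ).isBigO_integral A hB β (hρ γ) (hsub γ) (hd β γ) (hz β γ)
      (fun k => rMatrixOfRegularParts h k β γ) (Matrix.one_apply) (fun k => rfl) n

end RMatrix

end SpectralCurve

namespace SpectralCurve

variable {S : Type*} [TopologicalSpace S] [ChartedSpace ℂ S] [IsManifold 𝓘(ℂ) ω S]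
  {N : ℕ} {C : SpectralCurve S N}

/-! ### Quantum multiplication by the Euler vector. -/

section Euler

variable (A : AiryCoordinates C)

theorem invSqrtDelta_ne_zero (β : Fin N) : invSqrtDelta A β ≠ 0 := by
  have h0 := airy_zero_mem_target A β
  have hy : AnalyticAt ℂ (C.y ∘ (A.chart β).symm) 0 := by
    refine (contMDiffAt_iff_contDiffAt.1 (ContMDiffAt.comp (I' := 𝓘(ℂ)) 0 ?_
      (contMDiffAt_symm_of_mem_maximalAtlas (A.mem_maximalAtlas β) h0))).analyticAt
    rw [airy_symm_zero]; exact C.holomorphic_y β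
  have hv := velocity_symm_ne_zero (A.mem_maximalAtlas β) (A.mem_source β)
  rw [A.chart_crit] at hv
  rw [invSqrtDelta, ← pullback_differential (A.mem_maximalAtlas β) h0 hy.differentiableAt,
    OneForm.pullback, airy_symm_zero]
  exact mul_ne_zero (C.dy_ne_zero β) hv

/-- The function `y` only scales the idempotents: the factor `dy/dη` in `E_0` cancels against its
inverse in the product, which is legitimate because `dy` does not vanish at the critical points. -/
theorem eulerMul_eq_diagonal :
    eulerMul A = Matrix.diagonal fun β => C.x (C.crit β) := by
  have hE : ∀ β, eulerVector A β = C.x (C.crit β) * invSqrtDelta A β := by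
    intro β
    simp [eulerVector, canonicalBasis, Finset.sum_apply, Pi.single_apply]
  ext β γ
  have h := invSqrtDelta_ne_zero A β
  rw [eulerMul, LinearMap.toMatrix'_apply, quantumMul, LinearMap.mk₂_apply, hE]
  rcases eq_or_ne β γ with rfl | hne
  · simp; field_simp
  · simp [hne]

theorem lie_eulerMul_apply (M : Matrix (Fin N) (Fin N) ℂ) (β γ : Fin N) :
    ⁅M, eulerMul A⁆ β γ = M β γ * (C.x (C.crit γ) - C.x (C.crit β)) := by
  rw [eulerMul_eq_diagonal, Ring.lie_def, Matrix.sub_apply, Matrix.mul_diagonal,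
    Matrix.diagonal_mul]
  ring

end Euler

/-! ### The defect of homogeneity over `dx`: local behaviour and global vanishing. -/

section Defect

variable [T2Space S] (A : AiryCoordinates C) {B : BiDifferential S}

/-- The defect of homogeneity near a critical point. -/
theorem defectForm_div_airy (hB : IsBergmanKernel B) {γ : Fin N} {h : Fin N → ℂ → ℂ}
    (ha : ∀ β, AnalyticAt ℂ (h β) 0)
    (hz : ∀ β, ∀ᶠ t in 𝓝[≠] (0 : ℂ), (dzetaZero A B β).pullback (A.chart γ).symm t =
      -(if β = γ then 1 else 0) / t ^ 2 + h β t) (β : Fin N) (c : Fin N → ℂ)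
    (hc : c γ = (3 / 2 : ℂ) * (if β = γ then 1 else 0) -
      (C.x (C.crit γ) - C.x (C.crit β)) * h β 0) :
    ∀ᶠ t in 𝓝[≠] (0 : ℂ), defectForm A B β c ((A.chart γ).symm t) /
        differential C.x ((A.chart γ).symm t) =
      (-(C.x (C.crit γ) - C.x (C.crit β)) * derivDslope (h β) t - t * deriv (h β) t / 2 -
        (∑ δ, c δ * h δ t - h β t / 2)) / t := by
  have hsp := C.eventually_notMem_special (A.mem_source γ)
  rw [A.chart_crit] at hsp
  have hz' : ∀ᶠ t in 𝓝 (0 : ℂ), ∀ᶠ s in 𝓝 t, s ≠ 0 →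
      (dzetaZero A B β).pullback (A.chart γ).symm s = -(if β = γ then 1 else 0) / s ^ 2 + h β s :=
    eventually_eventually_nhds.2 (eventually_nhdsWithin_iff.1 (hz β))
  filter_upwards [hsp, self_mem_nhdsWithin, mem_nhdsWithin_of_mem_nhds hz',
    mem_nhdsWithin_of_mem_nhds (ha β).eventually_analyticAt, eventually_all.2 hz]
    with t ⟨h1, h2, h3⟩ ht h5 h6 h7
  have ht0 : t ≠ 0 := ht
  rw [defectForm_div_comp_symm A hB β c (A.mem_maximalAtlas γ) h1 h2 h3,
    deriv_x_comp_airy_symm A h1, x_airy_symm A h1]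
  set δ : ℂ := if β = γ then 1 else 0 with hδ
  have e1 : (fun v => (dzetaZero A B β).pullback (A.chart γ).symm v /
      deriv (C.x ∘ (A.chart γ).symm) v) =ᶠ[𝓝 t] fun v => (-δ / v ^ 2 + h β v) / v := by
    filter_upwards [h5, isOpen_ne.mem_nhds ht0, (A.chart γ).open_target.mem_nhds h1]
      with s hs hs0 hst
    rw [hs hs0, deriv_x_comp_airy_symm A hst]
  have e2 : HasDerivAt (fun v => (-δ / v ^ 2 + h β v) / v)
      (3 * δ / t ^ 4 + (deriv (h β) t / t - h β t / t ^ 2)) t := by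
    have := (((hasDerivAt_const t (-δ)).div (hasDerivAt_pow 2 t) (pow_ne_zero 2 ht0)).add
      h6.differentiableAt.hasDerivAt).div (hasDerivAt_id' t) ht0
    refine this.congr_deriv ?_
    simp only [Pi.add_apply, Pi.div_apply]
    push_cast
    field_simp
    ring
  have e3 : ∑ ε, c ε * (dzetaZero A B ε).pullback (A.chart γ).symm t =
      -c γ / t ^ 2 + ∑ ε, c ε * h ε t := by
    have : ∀ ε, c ε * (dzetaZero A B ε).pullback (A.chart γ).symm t =
        (if ε = γ then -c γ / t ^ 2 else 0) + c ε * h ε t := by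
      intro ε
      rw [h7 ε]
      split_ifs with he
      · subst he; ring
      · ring
    simp only [this, Finset.sum_add_distrib, Finset.sum_ite_eq', Finset.mem_univ, if_true]
  -- The fourth-order pole has coefficient `-3 (x^γ - x^β) δ`, and `δ` is nonzero only for `β = γ`.
  have e4 : (C.x (C.crit γ) - C.x (C.crit β)) * δ = 0 := by
    rw [hδ]
    split_ifs with he
    · rw [he]; ring
    · ring
  -- The remaining `t⁻²` coefficient of the form is `-3δ/2 + (x^γ - x^β) h_β(0) + c_γ`: `3/2` comes
  -- from differentiating `t⁻³` and multiplying by `t^2/2`, and `hc` is exactly its vanishing.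
  rw [e1.deriv_eq, e2.deriv, e3, hc, derivDslope_of_ne ht0 h6.differentiableAt]
  congr 1
  field_simp
  linear_combination (-6 : ℂ) * e4

/-- The defect of homogeneity away from the critical points. -/
theorem exists_analytic_defectForm_div (hB : IsBergmanKernel B) (β : Fin N) (c : Fin N → ℂ)
    {p : S} (hp : p ∉ range C.crit) :
    ∃ h : ℂ → ℂ, AnalyticAt ℂ h (chartAt ℂ p p) ∧
      (fun p => defectForm A B β c p / differential C.x p) ∘ (chartAt ℂ p).symm
        =ᶠ[𝓝[≠] (chartAt ℂ p p)] h ∧ (p ∈ C.bdry → h (chartAt ℂ p p) = 0) ∧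
      (p ∉ C.bdry → h (chartAt ℂ p p) = defectForm A B β c p / differential C.x p) := by
  have hs := mem_chart_source ℂ p
  have ht := mem_chart_target ℂ p
  have hφ := chartAt_mem_complexAtlas p
  set φ := chartAt ℂ p
  have hps : φ.symm (φ p) = p := φ.left_inv hs
  have hz : ∀ γ, AnalyticAt ℂ ((dzetaZero A B γ).pullback φ.symm) (φ p) := fun γ =>
    analyticAt_pullback_dzetaZero A hB γ hφ ht (by rw [hps]; exact fun h => hp ⟨γ, h.symm⟩)
  have hsum : AnalyticAt ℂ (fun w => ∑ γ, c γ * (dzetaZero A B γ).pullback φ.symm w) (φ p) :=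
    Finset.analyticAt_fun_sum _ fun γ _ => analyticAt_const.mul (hz γ)
  have hsp := C.eventually_notMem_special hs
  by_cases hb : p ∈ C.bdry
  · obtain ⟨v, q, hv, hq, hq0, he⟩ := exists_pole_form (C.pole_x p hb).1 (C.pole_x p hb).2
    set z := (dzetaZero A B β).pullback φ.symm with hzdef
    have hzq : AnalyticAt ℂ (fun w => z w * q w) (φ p) := (hz β).mul hq
    -- With `x = 1 / v` and `dx = -dw / (q v)`, the quotient `z / dx` is `-z q v`. Because `q v' =
    -- v`, its derivative is divisible by `v`, which cancels the pole of `x`; the final division by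
    -- `dx` contributes the factor `-q v`, and `q` vanishes at the pole.
    refine ⟨fun w => -(((1 - C.x (C.crit β) * v w) * (deriv (fun w => z w * q w) w + z w) -
      ∑ γ, c γ * (dzetaZero A B γ).pullback φ.symm w) * (q w * v w)), ?_, ?_, ?_, ?_⟩
    · exact ((((analyticAt_const.sub (analyticAt_const.mul hv)).mul
        (hzq.deriv.add (hz β))).sub hsum).mul (hq.mul hv)).neg
    · have he' := eventually_eventually_nhds.2 (eventually_nhdsWithin_iff.1 he)
      filter_upwards [hsp, he, mem_nhdsWithin_of_mem_nhds he', self_mem_nhdsWithin,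
        mem_nhdsWithin_of_mem_nhds hv.eventually_analyticAt,
        mem_nhdsWithin_of_mem_nhds hzq.eventually_analyticAt]
        with w ⟨h1, h2, h3⟩ ⟨g1, g2, g3, g4, g5⟩ g6 hw hvw hzw
      have e1 : (fun s => z s / deriv (C.x ∘ φ.symm) s) =ᶠ[𝓝 w]
          fun s => -(z s * q s * v s) := by
        filter_upwards [g6, isOpen_ne.mem_nhds hw] with s hs1 hs2
        obtain ⟨k1, k2, -, -, k5⟩ := hs1 hs2
        rw [k5]; field_simp
      have e2 : HasDerivAt (fun s => -(z s * q s * v s))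
          (-(deriv (fun w => z w * q w) w * v w + z w * q w * deriv v w)) w :=
        (hzw.differentiableAt.hasDerivAt.mul hvw.differentiableAt.hasDerivAt).neg
      have e3 : C.x (φ.symm w) = 1 / v w := g4
      rw [Function.comp_apply, defectForm_div_comp_symm A hB β c hφ h1 h2 h3, e1.deriv_eq, e2.deriv,
        g5, e3, mul_assoc (z w), g3]
      field_simp
    · intro _
      have hq0' : q (φ p) = 0 := hq0
      simp [hq0']
    · exact fun h => absurd hb h
  · have hpb : φ.symm (φ p) ∉ C.bdry := by rwa [hps]
    have hpc : φ.symm (φ p) ∉ range C.crit := by rwa [hps]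
    have hX := analyticAt_x hφ ht hpb
    have hX0 := deriv_x_ne_zero hφ ht hpb hpc
    refine ⟨_, ((((hX.sub (analyticAt_const (v := C.x (C.crit β)))).mul
      ((hz β).div hX.deriv hX0).deriv.neg).sub hsum).div hX.deriv hX0), ?_,
      fun h => absurd h hb, fun _ => ?_⟩
    · filter_upwards [hsp] with w ⟨h1, h2, h3⟩
      exact defectForm_div_comp_symm A hB β c hφ h1 h2 h3
    · have := defectForm_div_comp_symm A hB β c hφ ht hpb hpc
      rw [hps] at this
      rw [this]
      simp only [Pi.sub_apply, Pi.mul_apply, Pi.div_apply, Pi.neg_apply, Function.comp_apply, hps]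
      rfl

variable [CompactSpace S] [PreconnectedSpace S]

/-- Without poles `x` would be holomorphic on a compact connected surface, hence constant, against
`x = x^γ + t^2/2` near a critical point. -/
theorem bdry_nonempty (A : AiryCoordinates C) (γ : Fin N) : C.bdry.Nonempty := by
  by_contra hcon
  rw [not_nonempty_iff_eq_empty] at hcon
  obtain ⟨c, hc⟩ := exists_eventuallyEq_const_of_removable C.x fun p =>
    ⟨chartAt ℂ p, chartAt_mem_complexAtlas p, mem_chart_source ℂ p, _,
      analyticAt_x (chartAt_mem_complexAtlas p) (mem_chart_target ℂ p) (by simp [hcon]),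
      EventuallyEq.rfl⟩
  have h1 := hc (C.crit γ) (A.chart γ) (A.mem_source γ)
  rw [A.chart_crit] at h1
  have h0 := airy_zero_mem_target A γ
  have h2 : ∀ᶠ t in 𝓝[≠] (0 : ℂ), C.x (C.crit γ) + t ^ 2 / 2 = c := by
    filter_upwards [h1, mem_nhdsWithin_of_mem_nhds ((A.chart γ).open_target.mem_nhds h0)]
      with t ht ht'
    rw [← x_airy_symm A ht']; exact ht
  have h3 : C.x (C.crit γ) = c := by
    have h4 : Tendsto (fun t : ℂ => C.x (C.crit γ) + t ^ 2 / 2) (𝓝[≠] 0)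
        (𝓝 (C.x (C.crit γ) + 0 ^ 2 / 2)) :=
      (Continuous.tendsto (by fun_prop) 0).mono_left nhdsWithin_le_nhds
    have h5 := tendsto_nhds_unique (h4.congr' h2) tendsto_const_nhds
    simpa using h5
  obtain ⟨t, ht, ht0⟩ := (h2.and self_mem_nhdsWithin).exists
  rw [h3] at ht
  exact ht0 (by simpa using ht)

/-- If the defect of homogeneity over `dx` extends holomorphically over the critical points, then it
vanishes. -/
theorem defectForm_eq_zero (hB : IsBergmanKernel B) (β : Fin N) (c : Fin N → ℂ)
    (hcrit : ∀ γ, ∃ h : ℂ → ℂ, AnalyticAt ℂ h 0 ∧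
      (fun p => defectForm A B β c p / differential C.x p) ∘ (A.chart γ).symm =ᶠ[𝓝[≠] 0] h)
    {p : S} (hp : p ∉ C.bdry) (hp' : p ∉ range C.crit) : defectForm A B β c p = 0 := by
  obtain ⟨k, hk⟩ := exists_eventuallyEq_const_of_removable
    (fun p => defectForm A B β c p / differential C.x p) (by
      intro p
      by_cases hpc : p ∈ range C.crit
      · obtain ⟨γ, rfl⟩ := hpc
        obtain ⟨h, ha, he⟩ := hcrit γ
        refine ⟨A.chart γ, A.mem_maximalAtlas γ, A.mem_source γ, h, ?_, ?_⟩
        · rwa [A.chart_crit]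
        · rwa [A.chart_crit]
      · obtain ⟨h, ha, he, -⟩ := exists_analytic_defectForm_div A hB β c hpc
        exact ⟨chartAt ℂ p, chartAt_mem_complexAtlas p, mem_chart_source ℂ p, h, ha, he⟩)
  have value : ∀ q, ∀ h : ℂ → ℂ, AnalyticAt ℂ h (chartAt ℂ q q) →
      (fun p => defectForm A B β c p / differential C.x p) ∘ (chartAt ℂ q).symm
        =ᶠ[𝓝[≠] (chartAt ℂ q q)] h → h (chartAt ℂ q q) = k := by
    intro q h ha he
    have h1 := (he.symm.trans (hk q (chartAt ℂ q) (mem_chart_source ℂ q)))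
    have h2 : Tendsto h (𝓝[≠] (chartAt ℂ q q)) (𝓝 (h (chartAt ℂ q q))) :=
      ha.continuousAt.tendsto.mono_left nhdsWithin_le_nhds
    exact tendsto_nhds_unique (h2.congr' h1) tendsto_const_nhds
  -- The constant produced by Liouville's theorem is identified at a pole of `x`, where the quotient
  -- by `dx` extends by zero.
  obtain ⟨b, hb⟩ := bdry_nonempty A β
  have hbc : b ∉ range C.crit := fun h => ((C.mem_range_crit_iff b).1 h).1 hb
  obtain ⟨h, ha, he, h0, -⟩ := exists_analytic_defectForm_div A hB β c hbc
  have hk0 : k = 0 := by rw [← value b h ha he, h0 hb]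
  obtain ⟨h, ha, he, -, h1⟩ := exists_analytic_defectForm_div A hB β c hp'
  have h2 := value p h ha he
  rw [h1 hp, hk0, div_eq_zero_iff] at h2
  exact h2.resolve_right fun h3 => hp' ((C.mem_range_crit_iff p).2 ⟨hp, h3⟩)

end Defect

end SpectralCurve

/-! ### Homogeneity versus the recursion. -/

open SpectralCurve in
/-- Homogeneity is equivalent to the recursion, for the `R`-matrix given by regular parts. -/
theorem SpectralCurve.isHomogeneous_iff {S : Type*} [TopologicalSpace S] [ChartedSpace ℂ S]
    [IsManifold 𝓘(ℂ) ω S] [T2Space S] [CompactSpace S] [PreconnectedSpace S] {N : ℕ}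
    {C : SpectralCurve S N} (A : AiryCoordinates C) {B : BiDifferential S}
    (hB : IsBergmanKernel B) {h : Fin N → Fin N → ℂ → ℂ} (ha : ∀ β γ, AnalyticAt ℂ (h β γ) 0)
    (hz : ∀ β γ, ∀ᶠ t in 𝓝[≠] (0 : ℂ), (dzetaZero A B β).pullback (A.chart γ).symm t =
      -(if β = γ then 1 else 0) / t ^ 2 + h β γ t) :
    IsHomogeneous A B (rMatrixOfRegularParts h) ↔
      ∀ m : ℕ, ⁅rMatrixOfRegularParts h (m + 1), eulerMul A⁆ =
        ((m : ℂ) • (1 : Matrix (Fin N) (Fin N) ℂ) + mu A (rMatrixOfRegularParts h)) *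
          rMatrixOfRegularParts h m := by
  set R := rMatrixOfRegularParts h with hR
  set M := mu A R with hM
  have hR1 : ∀ k β γ, R (k + 1) β γ = (-1) ^ (k + 1) * derivDslope^[k] (h β γ) 0 :=
    fun k β γ => rfl
  have hMe : ∀ β γ, M β γ = -(C.x (C.crit γ) - C.x (C.crit β)) * h β γ 0 := by
    intro β γ
    rw [hM, mu, lie_eulerMul_apply, hR1 0]
    simp only [Function.iterate_zero, id]
    ring
  have hce : ∀ β γ, (M + (3 / 2 : ℂ) • (1 : Matrix (Fin N) (Fin N) ℂ)) β γ =
      (3 / 2 : ℂ) * (if β = γ then 1 else 0) - (C.x (C.crit γ) - C.x (C.crit β)) * h β γ 0 := by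
    intro β γ
    rw [Matrix.add_apply, Matrix.smul_apply, Matrix.one_apply, hMe, smul_eq_mul]
    ring
  -- the equation near `z^γ`
  have hsumM : ∀ β γ, ∀ t : ℂ,
      -- The shift `3/2` becomes `1` because `(x - x^β) dζ_1^β` contributes `h_{βγ} / 2` through the
      -- term `t^2/2` of `x`.
      ∑ δ, (M + (3 / 2 : ℂ) • (1 : Matrix (Fin N) (Fin N) ℂ)) β δ * h δ γ t - h β γ t / 2 =
        ∑ δ, (M + 1) β δ * h δ γ t := by
    intro β γ t
    simp only [Matrix.add_apply, Matrix.smul_apply, Matrix.one_apply, add_mul,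
      Finset.sum_add_distrib, smul_eq_mul, mul_ite, mul_one, mul_zero, ite_mul, zero_mul, one_mul,
      Finset.sum_ite_eq, Finset.mem_univ, if_true]
    ring
  -- the recursion, entry by entry
  have hrec : ∀ k β γ, (⁅R (k + 2), eulerMul A⁆ β γ =
      ((((k + 1 : ℕ) : ℂ) • (1 : Matrix (Fin N) (Fin N) ℂ) + M) * R (k + 1)) β γ) ↔
      -(C.x (C.crit γ) - C.x (C.crit β)) * derivDslope^[k + 1] (h β γ) 0 =
        k * derivDslope^[k] (h β γ) 0 + ∑ δ, (M + 1) β δ * derivDslope^[k] (h δ γ) 0 := by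
    intro k β γ
    have hne : ((-1 : ℂ)) ^ (k + 1) ≠ 0 := pow_ne_zero _ (by norm_num)
    have e1 : ∑ δ, (M + 1) β δ * derivDslope^[k] (h δ γ) 0 =
        ∑ δ, M β δ * derivDslope^[k] (h δ γ) 0 + derivDslope^[k] (h β γ) 0 := by
      simp only [Matrix.add_apply, Matrix.one_apply, add_mul, Finset.sum_add_distrib, ite_mul,
        one_mul, zero_mul, Finset.sum_ite_eq, Finset.mem_univ, if_true]
    have e2 : ((((k + 1 : ℕ) : ℂ) • (1 : Matrix (Fin N) (Fin N) ℂ) + M) * R (k + 1)) β γ =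
        (-1) ^ (k + 1) * ((k + 1) * derivDslope^[k] (h β γ) 0 +
          ∑ δ, M β δ * derivDslope^[k] (h δ γ) 0) := by
      rw [add_mul, smul_mul_assoc, one_mul, Matrix.add_apply, Matrix.smul_apply, Matrix.mul_apply,
        hR1, smul_eq_mul, mul_add, Finset.mul_sum]
      push_cast
      congr 1
      · ring
      · exact Finset.sum_congr rfl fun δ _ => by rw [hR1]; ring
    rw [lie_eulerMul_apply, hR1 (k + 1), e2, e1, pow_succ]
    constructor
    · intro H
      refine mul_left_cancel₀ hne ?_
      linear_combination H
    · intro H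
      linear_combination (-1) ^ (k + 1) * H
  have hhom : IsHomogeneous A B R ↔ ∀ β p, p ∉ C.bdry → p ∉ range C.crit →
      defectForm A B β ((M + (3 / 2 : ℂ) • (1 : Matrix (Fin N) (Fin N) ℂ)) β) p = 0 := by
    refine forall_congr' fun β => forall_congr' fun p => forall_congr' fun _ =>
      forall_congr' fun _ => ?_
    rw [defectForm, sub_eq_zero]
  have hPa : ∀ β γ, AnalyticAt ℂ (fun t =>
      -(C.x (C.crit γ) - C.x (C.crit β)) * derivDslope (h β γ) t - t * deriv (h β γ) t / 2 -
        ∑ δ, (M + 1) β δ * h δ γ t) 0 := by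
    intro β γ
    have a1 : AnalyticAt ℂ (fun t => ∑ δ, (M + 1) β δ * h δ γ t) 0 :=
      Finset.analyticAt_fun_sum _ fun δ _ => analyticAt_const.mul (ha δ γ)
    exact ((analyticAt_const.mul (ha β γ).derivDslope).sub
      ((analyticAt_id.mul (ha β γ).deriv).div_const)).sub a1
  have hloc := fun β γ => defectForm_div_airy A hB (fun β => ha β γ) (fun β => hz β γ) β
    ((M + (3 / 2 : ℂ) • (1 : Matrix (Fin N) (Fin N) ℂ)) β) (hce β γ)
  simp only [hsumM] at hloc
  rw [hhom]
  constructor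
  · intro H m
    -- At `m = 0` the recursion is the definition of `μ`, because `R_0 = 1`.
    rcases m with _ | k
    · have hR0 : R 0 = 1 := rfl
      rw [hR0, Nat.cast_zero, zero_smul, zero_add, zero_add, mul_one]; rfl
    ext β γ
    refine (hrec k β γ).2 (iterate_derivDslope_recursion (ha β γ) (fun δ => ha δ γ) _ _ ?_ k)
    have h1 : ∀ᶠ t in 𝓝[≠] (0 : ℂ),
        -(C.x (C.crit γ) - C.x (C.crit β)) * derivDslope (h β γ) t - t * deriv (h β γ) t / 2 -
          ∑ δ, (M + 1) β δ * h δ γ t = 0 := by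
      have hsp := C.eventually_notMem_special (A.mem_source γ)
      rw [A.chart_crit] at hsp
      filter_upwards [hloc β γ, hsp, self_mem_nhdsWithin] with t h1 ⟨_, h2, h3⟩ ht
      rw [H β _ h2 h3, zero_div] at h1
      exact (div_eq_zero_iff.1 h1.symm).resolve_right ht
    -- Homogeneity gives the equation only off the critical point; by the isolated zeros principle
    -- it extends to the full germ, as iterating `derivDslope` at `0` requires.
    have h2 := ((hPa β γ).eventually_eq_or_eventually_ne analyticAt_const (g := fun _ => 0))
    have h3 := h2.resolve_right fun h4 => by
      obtain ⟨t, h5, h6⟩ := (h1.and h4).exists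
      exact h6 h5
    filter_upwards [h3] with t ht
    linear_combination ht
  · intro H β p hp hp'
    refine defectForm_eq_zero A hB β _ (fun γ => ?_) hp hp'
    -- Only the recursion at `m = 1` is used: it says that the numerator over `t` vanishes at `t =
    -- 0`, so the quotient is the difference quotient of an analytic germ.
    have h0 := (hrec 0 β γ).1 (congrFun (congrFun (H 1) β) γ)
    refine ⟨_, (hPa β γ).dslope_zero, ?_⟩
    filter_upwards [hloc β γ, self_mem_nhdsWithin] with t h1 ht
    rw [Function.comp_apply, h1, dslope_zero_of_ne _ ht]
    congr 1
    simp only [Nat.cast_zero, zero_mul, zero_add, Function.iterate_one, Function.iterate_zero,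
      id] at h0
    rw [h0]
    ring

theorem mainTheorem6 {S : Type*} [TopologicalSpace S] [ChartedSpace ℂ S] [IsManifold 𝓘(ℂ) ω S]
    [T2Space S] [CompactSpace S] [ConnectedSpace S] {N : ℕ}
    (C : SpectralCurve S N) (A : AiryCoordinates C)
    (B : BiDifferential S) (hB : IsBergmanKernel B)
    (L : ∀ γ, SpectralCurve.LefschetzThimble A γ) :
    (∃! R : ℕ → Matrix (Fin N) (Fin N) ℂ, SpectralCurve.IsRMatrix B L R) ∧
      ∀ R : ℕ → Matrix (Fin N) (Fin N) ℂ, SpectralCurve.IsRMatrix B L R →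
        (SpectralCurve.IsHomogeneous A B R ↔
          ∀ m : ℕ, ⁅R (m + 1), SpectralCurve.eulerMul A⁆ =
            ((m : ℂ) • (1 : Matrix (Fin N) (Fin N) ℂ) + SpectralCurve.mu A R) * R m) := by
  obtain ⟨h, ha, hz, hR⟩ := SpectralCurve.exists_regularParts A hB L
  refine ⟨⟨_, hR, fun R' hR' => hR'.unique hR⟩, fun R' hR' => ?_⟩
  rw [hR'.unique hR]
  exact SpectralCurve.isHomogeneous_iff A hB ha hz
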